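/- Let $\{\phi_j\}_{j\ge1}$ be the trigonometric orthonormal basis of $L^2[0,1]$ ($\phi_1=1$, $\phi_{2m}(t)=\sqrt2\cos(2\pi mt)$, $\phi_{2m+1}(t)=\sqrt2\sin(2\pi mt)$ for $m\ge1$), let $\|\cdot\|$ be the norm of $L^2[0,1]$ and, for $\alpha,Q>0$, let $$E_\alpha(Q)=\Big\{f\in L^2[0,1]:\ \sum_{j\ge1}j^{2\alpha}\theta_j^2\le Q^2,\ \theta_j=\int_0^1 f\phi_j\Big\},\qquad \epsilon_n=n^{-\alpha/(2\alpha+1)}.$$ **Block prior.** Put $l_k=\lfloor e^k\rfloor$ and $B_k=\{l_k,\dots,l_{k+1}-1\}$ for $k\ge0$, so that the blocks $B_k$ partition $\{1,2,3,\dots\}$. Let $(g_k)_{k\ge0}$ be probability densities on $(0,\infty)$ for which there are constants $c_1,c_2,c_3>0$ such that, for all $k\ge0$, $$g_k(t)\ge e^{-c_1e^k}\ \text{ for all } t\in[e^{-k^2},e^{-k}],\qquad \int_0^\infty t\,g_k(t)\,dt\le 4e^{-c_2k^2},\qquad \int_{e^{-k^2}}^\infty g_k(t)\,dt\le e^{-c_3e^k}.$$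 The block prior $\bar\Pi$ is the law of the random function $f=\sum_{j\ge1}\theta_j\phi_j$, where the scales $A_k\sim g_k$ are independent and, given the scales, the blocks $(\theta_j)_{j\in B_k}$ are independent with law $N(0,A_kI)$. It depends neither on $\alpha,Q$ nor on $n$. **White noise model.** For $f\in L^2[0,1]$ let $P_f^{(n)}$ be the law of the process $Y_t^{(n)}=\int_0^tf(s)\,ds+n^{-1/2}W_t$, $t\in[0,1]$ (that is, $dY_t^{(n)}=f(t)\,dt+n^{-1/2}\,dW_t$), where $W$ is a standard Wiener process. Let $\bar\Pi(\cdot\mid Y^{(n)})$ be the posterior distribution, that is, the conditional distribution of $f$ given $Y^{(n)}$ when $f\sim\bar\Pi$ and $Y^{(n)}\mid f\sim P_f^{(n)}$. **Theorem.** For all $\alpha>0$ and $Q>0$ there is a constant $M>0$ such that $$\sup_{f_0\in E_\alpha(Q)}P_{f_0}^{(n)}\,\bar\Pi\big(\|f-f_0\|>M\epsilon_n\ \big|\ Y^{(n)}\big)\longrightarrow0\qquad(n\to\infty),$$ where $P_{f_0}^{(n)}$ denotes expectation over $Y^{(n)}\sim P_{f_0}^{(n)}$. -/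

import Mathlib

open MeasureTheory ProbabilityTheory Filter Topology
open scoped ENNReal NNReal

noncomputable section

namespace BlockPrior

/-! ### Signals on `[0,1]`, the trigonometric basis and Sobolev balls -/

/-- The space `L²[0,1]` of signals (with Lebesgue measure on `[0,1]`). -/
abbrev Signal : Type := Lp ℝ 2 (volume : Measure unitInterval)

/-- `L²[0,1]` carries its Borel σ-algebra. -/
instance : MeasurableSpace Signal := borel Signal

instance : BorelSpace Signal := ⟨rfl⟩

instance : PolishSpace Signal := by
  have : Fact ((2 : ℝ≥0∞) ≠ ∞) := ⟨by simp⟩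
  infer_instance

/-- The trigonometric orthonormal basis of `L²[0,1]`, indexed by `j = 1, 2, 3, …`:
`φ₁ = 1`, `φ₂ₘ(t) = √2 cos(2πmt)`, `φ₂ₘ₊₁(t) = √2 sin(2πmt)` for `m ≥ 1`.
(The value at `j = 0` is never used.) -/
def trig (j : ℕ) (t : unitInterval) : ℝ :=
  if j = 1 then 1
  else if Even j then √2 * Real.cos (2 * Real.pi * (j / 2 : ℕ) * t)
  else √2 * Real.sin (2 * Real.pi * (j / 2 : ℕ) * t)

theorem continuous_trig (j : ℕ) : Continuous (trig j) := by
  unfold trig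
  split_ifs <;> fun_prop

/-- The basis function `φ_j` as an element of `L²[0,1]`. -/
def trigL2 (j : ℕ) : Signal :=
  ContinuousMap.toLp 2 volume ℝ ⟨trig j, continuous_trig j⟩

/-- The `j`-th Fourier coefficient `θ_j = ∫ f φ_j`. -/
def fourierCoef (f : Signal) (j : ℕ) : ℝ := ∫ t, f t * trig j t

/-- The Sobolev ball `E_α(Q) = {f ∈ L²[0,1] : ∑_{j ≥ 1} j^{2α} θ_j² ≤ Q²}`. -/
def sobolevBall (α Q : ℝ) : Set Signal :=
  {f | ∑' j : ℕ, ENNReal.ofReal (((j + 1 : ℕ) : ℝ) ^ (2 * α) * fourierCoef f (j + 1) ^ 2)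
      ≤ ENNReal.ofReal (Q ^ 2)}

/-! ### The block prior -/

/-- The left end points `l_k = [e^k]` of the blocks `B_k = {l_k, …, l_{k+1} - 1}`. -/
def blockStart (k : ℕ) : ℕ := ⌊Real.exp k⌋₊

/-- The number `k` of the block `B_k` that contains the index `j ≥ 1`. -/
def blockIndex (j : ℕ) : ℕ := Nat.findGreatest (fun k => blockStart k ≤ j) j

/-- `blockIndex j = k` does mean `j ∈ B_k`. -/
theorem blockIndex_spec {j : ℕ} (hj : 1 ≤ j) :
    blockStart (blockIndex j) ≤ j ∧ j < blockStart (blockIndex j + 1) := by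
  have h0 : blockStart 0 ≤ j := by simpa [blockStart] using hj
  refine ⟨Nat.findGreatest_spec (P := fun k => blockStart k ≤ j) (Nat.zero_le j) h0, ?_⟩
  by_contra! h
  have hk : blockIndex j + 1 ≤ j := by
    refine le_trans ?_ h
    refine Nat.le_floor ?_
    linarith [Real.add_one_le_exp ((blockIndex j + 1 : ℕ) : ℝ)]
  exact Nat.findGreatest_is_greatest (P := fun k => blockStart k ≤ j)
    (Nat.lt_succ_self _) hk h

/-- A sequence `g_0, g_1, g_2, …` of probability densities on `(0, ∞)`.
(The values of `g_k` on `(-∞, 0]` play no role.) -/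
structure MixingDensities where
  /-- the densities -/
  g : ℕ → ℝ → ℝ
  measurable (k : ℕ) : Measurable (g k)
  nonneg (k : ℕ) (t : ℝ) : 0 < t → 0 ≤ g k t
  lintegral_eq_one (k : ℕ) : ∫⁻ t in Set.Ioi (0 : ℝ), ENNReal.ofReal (g k t) = 1

/-- The class `𝒢` of mixing densities. -/
structure MixingDensities.InClass (G : MixingDensities) : Prop where
  /-- `g_k(t) ≥ exp(-c₁ e^k)` for all `t ∈ [e^{-k²}, e^{-k}]` -/
  lower : ∃ c : ℝ, 0 < c ∧ ∀ k : ℕ,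
    ∀ t ∈ Set.Icc (Real.exp (-(k : ℝ) ^ 2)) (Real.exp (-(k : ℝ))),
      Real.exp (-(c * Real.exp k)) ≤ G.g k t
  /-- `∫_0^∞ t g_k(t) dt ≤ 4 exp(-c₂ k²)` -/
  mean : ∃ c : ℝ, 0 < c ∧ ∀ k : ℕ,
    ∫⁻ t in Set.Ioi (0 : ℝ), ENNReal.ofReal (t * G.g k t)
      ≤ ENNReal.ofReal (4 * Real.exp (-(c * (k : ℝ) ^ 2)))
  /-- `∫_{e^{-k²}}^∞ g_k(t) dt ≤ exp(-c₃ e^k)` -/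
  tail : ∃ c : ℝ, 0 < c ∧ ∀ k : ℕ,
    ∫⁻ t in Set.Ioi (Real.exp (-(k : ℝ) ^ 2)), ENNReal.ofReal (G.g k t)
      ≤ ENNReal.ofReal (Real.exp (-(c * Real.exp k)))

/-- The law on `ℝ` of the scale `A_k ∼ g_k`. -/
def scaleLaw (G : MixingDensities) (k : ℕ) : Measure ℝ :=
  (volume.restrict (Set.Ioi 0)).withDensity fun t => ENNReal.ofReal (G.g k t)

instance (G : MixingDensities) (k : ℕ) : IsProbabilityMeasure (scaleLaw G k) :=
  ⟨by rw [scaleLaw, withDensity_apply _ MeasurableSet.univ, Measure.restrict_univ,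
    G.lintegral_eq_one k]⟩

/-- The law of the coefficients under the block prior. The scales `A_k ∼ g_k` are independent,
and given the scales the blocks `θ_k = (θ_j)_{j ∈ B_k}` are independent with law `N(0, A_k I)`,
that is, `θ_j = √A_k Z_j` for `j ∈ B_k`, where the `Z_j` are i.i.d. `N(0,1)` and independent of the
scales. The entry of the sequence at the place `i = 0, 1, 2, …` is `θ_{i+1}`. -/
def coefPrior (G : MixingDensities) : Measure (ℕ → ℝ) :=
  ((Measure.infinitePi (scaleLaw G)).prod
    (Measure.infinitePi fun _ : ℕ => gaussianReal 0 1)).map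
      fun p i => √(p.1 (blockIndex (i + 1))) * p.2 i

/-- The signal `∑_{j ≥ 1} θ_j φ_j ∈ L²[0,1]`. (The block prior gives mass one to the sequences for
which the series converges.) -/
def synthesis (θ : ℕ → ℝ) : Signal := ∑' i : ℕ, θ i • trigL2 (i + 1)

/-- The block prior: the law of the random signal `f = ∑_j θ_j φ_j`. -/
def blockPrior (G : MixingDensities) : Measure Signal := (coefPrior G).map synthesis

instance (G : MixingDensities) : IsFiniteMeasure (coefPrior G) := by
  unfold coefPrior; infer_instance

instance (G : MixingDensities) : IsFiniteMeasure (blockPrior G) := by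
  unfold blockPrior; infer_instance

/-! ### The white noise model -/

/-- The law of the path `(W_t)_{0 ≤ t ≤ 1}`, a measure on `ℝ^{[0,1]}` with the product σ-algebra. -/
def pathLaw {Ω : Type*} [MeasurableSpace Ω] (P : Measure Ω) (W : ℝ≥0 → Ω → ℝ) :
    Measure (unitInterval → ℝ) :=
  P.map fun ω t => W (unitInterval.toNNReal t) ω

/-- The path `Y_t = ∫_0^t f(s) ds + n^{-1/2} w_t`, `0 ≤ t ≤ 1`, that is,
`dY_t = f(t) dt + n^{-1/2} dw_t` and `Y_0 = n^{-1/2} w_0`. -/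
def observedPath (n : ℕ) (f : Signal) (w : unitInterval → ℝ) : unitInterval → ℝ :=
  fun t => (∫ s in Set.Iic t, f s) + (n : ℝ) ^ (-(1 / 2) : ℝ) * w t

theorem measurable_drift (t : unitInterval) :
    Measurable fun f : Signal => ∫ s in Set.Iic t, f s := by
  have h : (fun f : Signal => ∫ s in Set.Iic t, f s) = fun f : Signal =>
      inner ℝ (indicatorConstLp 2 (measurableSet_Iic (a := t)) (measure_ne_top volume _) (1 : ℝ))
        f := by
    funext f
    rw [L2.inner_indicatorConstLp_one]
  rw [h]
  exact (continuous_const.inner continuous_id).measurable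

theorem measurable_observedPath (n : ℕ) :
    Measurable fun p : Signal × (unitInterval → ℝ) => observedPath n p.1 p.2 := by
  refine measurable_pi_lambda _ fun t => ?_
  exact ((measurable_drift t).comp measurable_fst).add
    (((measurable_pi_apply t).comp measurable_snd).const_mul _)

theorem measurable_observedPath_right (n : ℕ) (f : Signal) : Measurable (observedPath n f) :=
  (measurable_observedPath n).comp (measurable_prodMk_left (x := f))

/-- The white noise model with noise process `W`: the kernel that sends the signal `f` to the law
`P_f^{(n)}` of the process `Y_t = ∫_0^t f(s) ds + n^{-1/2} W_t`, `t ∈ [0,1]`. -/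
def whiteNoise {Ω : Type*} [MeasurableSpace Ω] (P : Measure Ω) [IsProbabilityMeasure P]
    (W : ℝ≥0 → Ω → ℝ) (n : ℕ) : Kernel Signal (unitInterval → ℝ) where
  toFun f := (pathLaw P W).map (observedPath n f)
  measurable' := by
    have : IsFiniteMeasure (pathLaw P W) := by unfold pathLaw; infer_instance
    refine Measure.measurable_of_measurable_coe _ fun s hs => ?_
    have h : ∀ f : Signal, (pathLaw P W).map (observedPath n f) s =
        pathLaw P W (Prod.mk f ⁻¹' ((fun p : Signal × (unitInterval → ℝ) =>
          observedPath n p.1 p.2) ⁻¹' s)) := fun f => by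
      rw [Measure.map_apply (measurable_observedPath_right n f) hs]
      rfl
    simp_rw [h]
    exact measurable_measure_prodMk_left (measurable_observedPath n hs)

instance {Ω : Type*} [MeasurableSpace Ω] (P : Measure Ω) [IsProbabilityMeasure P]
    (W : ℝ≥0 → Ω → ℝ) (n : ℕ) : IsFiniteKernel (whiteNoise P W n) := by
  have : IsFiniteMeasure (pathLaw P W) := by unfold pathLaw; infer_instance
  refine ⟨⟨pathLaw P W Set.univ, measure_lt_top _ _, fun f => ?_⟩⟩
  change (pathLaw P W).map (observedPath n f) Set.univ ≤ _
  rw [Measure.map_apply (measurable_observedPath_right n f)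
    MeasurableSet.univ, Set.preimage_univ]

/-- The posterior distribution `Π̄(· | Y^{(n)})` for the block prior, given the observed path: the
conditional distribution of the signal `f` given `Y^{(n)}` when `f ∼ Π̄` and
`Y^{(n)} | f ∼ P_f^{(n)}`. -/
def blockPosterior {Ω : Type*} [MeasurableSpace Ω] (P : Measure Ω) [IsProbabilityMeasure P]
    (W : ℝ≥0 → Ω → ℝ) (G : MixingDensities) (n : ℕ) : Kernel (unitInterval → ℝ) Signal :=
  posterior (whiteNoise P W n) (blockPrior G)

/-- The rate `ε_n = n^{-α/(2α+1)}`. -/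
def rate (α : ℝ) (n : ℕ) : ℝ := (n : ℝ) ^ (-(α / (2 * α + 1)))

end BlockPrior

end

open BlockPrior

noncomputable section

namespace BlockPrior

/-! Choose `K` with n ≍ e^{(2α+1)K}. Then ε_n² ≍ e^{-2αK} and nε_n² ≍ e^K, the number of
coefficients before the block `B_K`. The proof balances three estimates, all exponential in e^K and
uniform over f₀ in the Sobolev ball.

Prior mass (`exists_le_coefPrior_nearSet`, `exists_norm_synthesis_sub_sq_le`): a ball around f₀ of
squared radius B e^{-2αK} has mass at least exp(-C₁ e^K). For k < K the scales may be taken of order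
e^{-(2α+1)k}, at a cost of order e^k in the exponent. Given such scales, each coefficient before
`B_K` falls close to that of f₀ at a cost whose total is again of order e^K (`head_exponent_le`,
`sum_range_sub_log_le`).

Sieve (`exists_coefPrior_compl_tailSet_le`): with prior probability at least 1 - C₂ exp(-c e^{K+L})
the energy of f from the block `B_{K+L}` on is at most of order e^{-2αK}. A fixed large `L` makes
the exceptional mass negligible against exp(-C₁ e^K).

Test (`exists_test`): for f in the sieve the distance to f₀ is essentially visible in about e^{K+L}
coefficients, so a single chi-square test separates f₀ from all such f with ‖f - f₀‖ > Mε_n. No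
covering argument is needed.

These are combined in `lintegral_posterior_le`. The usual lower bound for the normalising constant
of the posterior is replaced by the two-point inequality P_{f₀}(D)² ≤ exp(n‖f - f₀‖²) P_f(D)
(`sq_whiteNoise_le`), which is Cauchy–Schwarz for the Cameron–Martin density. Neither Bayes' formula
nor a stochastic integral of a general function enters: everything is reduced to step functions,
whose integrals against a path are finite sums. -/

/-! ### The trigonometric system is a Hilbert basis of L²[0,1]. -/

theorem integral_unitInterval {E : Type*} [NormedAddCommGroup E] [NormedSpace ℝ E] (g : ℝ → E) :
    ∫ t : unitInterval, g t = ∫ x in (0 : ℝ)..1, g x := by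
  rw [intervalIntegral.integral_of_le zero_le_one, ← integral_Icc_eq_integral_Ioc]
  exact integral_subtype_comap measurableSet_Icc g

theorem integral_unitInterval_of_eq {E : Type*} [NormedAddCommGroup E] [NormedSpace ℝ E]
    {f : unitInterval → E} {g : ℝ → E} (h : ∀ t, f t = g t) :
    ∫ t, f t = ∫ x in (0 : ℝ)..1, g x := by
  simp_rw [h]
  exact integral_unitInterval g

theorem integral_cos_phase (k : ℤ) (c : ℝ) :
    ∫ x in (0 : ℝ)..1, Real.cos (2 * Real.pi * k * x - c) = if k = 0 then Real.cos c else 0 := by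
  split_ifs with h
  · simp [h]
  · have hk : (2 * Real.pi * k : ℝ) ≠ 0 := by
      have : (k : ℝ) ≠ 0 := by exact_mod_cast h
      positivity
    rw [intervalIntegral.integral_comp_mul_sub (fun x => Real.cos x) hk c, integral_cos]
    have : Real.sin (2 * Real.pi * k * 1 - c) = Real.sin (2 * Real.pi * k * 0 - c) := by
      rw [show 2 * Real.pi * (k : ℝ) * 1 - c = (2 * Real.pi * (k : ℝ) * 0 - c) + k * (2 * Real.pi) by
        ring, Real.sin_add_int_mul_two_pi]
    rw [this]
    simp

/-- The phase of the `j`-th trigonometric basis function. -/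
def phase (j : ℕ) : ℝ := if Even j then 0 else Real.pi / 2

/-- With sines written as shifted cosines, orthonormality becomes one product-to-sum computation
instead of three. -/
theorem trig_eq_cos {j : ℕ} (hj : 2 ≤ j) (t : unitInterval) :
    trig j t = √2 * Real.cos (2 * Real.pi * (j / 2 : ℕ) * t - phase j) := by
  unfold trig phase
  rw [if_neg (by omega)]
  split_ifs
  · simp
  · rw [Real.cos_sub_pi_div_two]

theorem inner_trigL2 (i j : ℕ) :
    inner ℝ (trigL2 i) (trigL2 j) = ∫ t, trig i t * trig j t := by
  rw [L2.inner_def]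
  refine integral_congr_ae ?_
  filter_upwards [ContinuousMap.coeFn_toLp (p := 2) (𝕜 := ℝ) volume
    (⟨trig i, continuous_trig i⟩ : C(unitInterval, ℝ)), ContinuousMap.coeFn_toLp (p := 2) (𝕜 := ℝ)
    volume (⟨trig j, continuous_trig j⟩ : C(unitInterval, ℝ))] with t h1 h2
  unfold trigL2
  rw [h1, h2]
  simp [mul_comm]

theorem inner_trigL2_left (f : Signal) (j : ℕ) : inner ℝ (trigL2 j) f = fourierCoef f j := by
  rw [L2.inner_def]
  refine integral_congr_ae ?_
  filter_upwards [ContinuousMap.coeFn_toLp (p := 2) (𝕜 := ℝ) volume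
    (⟨trig j, continuous_trig j⟩ : C(unitInterval, ℝ))] with t h1
  unfold trigL2
  rw [h1]
  simp

theorem integral_trig_mul_trig {i j : ℕ} (hi : 2 ≤ i) (hj : 2 ≤ j) :
    ∫ t, trig i t * trig j t = if i = j then 1 else 0 := by
  refine (integral_unitInterval_of_eq (g := fun x : ℝ => Real.cos (2 * Real.pi * (((i / 2 : ℕ) : ℤ) - ((j / 2 : ℕ) : ℤ) : ℤ) * x
        - (phase i - phase j)) + Real.cos (2 * Real.pi * (((i / 2 : ℕ) : ℤ) + ((j / 2 : ℕ) : ℤ) : ℤ)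
        * x - (phase i + phase j))) fun t => ?_).trans ?_
  · rw [trig_eq_cos hi, trig_eq_cos hj]
    have h2 : √2 * √2 = 2 := by norm_num
    set a := 2 * Real.pi * (i / 2 : ℕ) * (t : ℝ) - phase i
    set b := 2 * Real.pi * (j / 2 : ℕ) * (t : ℝ) - phase j
    have e1 : √2 * Real.cos a * (√2 * Real.cos b) = 2 * Real.cos a * Real.cos b := by
      linear_combination Real.cos a * Real.cos b * h2
    rw [e1, Real.two_mul_cos_mul_cos]
    simp only [a, b]
    generalize i / 2 = p
    generalize j / 2 = q
    congr 2 <;> · push_cast; ring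
  rw [intervalIntegral.integral_add
    (by apply Continuous.intervalIntegrable; fun_prop)
    (by apply Continuous.intervalIntegrable; fun_prop), integral_cos_phase, integral_cos_phase,
    if_neg (c := (((i / 2 : ℕ) : ℤ) + ((j / 2 : ℕ) : ℤ) = 0)) (by omega)]
  by_cases hij : i = j
  · simp [hij]
  · rw [if_neg hij, add_zero]
    split_ifs with h
    · have : ¬ (Even i ↔ Even j) := by
        rw [Nat.even_iff, Nat.even_iff]; omega
      unfold phase
      by_cases h1 : Even i <;> by_cases h2 : Even j <;> simp_all [-Nat.not_even_iff_odd]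
    · rfl

theorem orthonormal_trigL2 : Orthonormal ℝ fun i : ℕ => trigL2 (i + 1) := by
  rw [orthonormal_iff_ite]
  intro i j
  rw [inner_trigL2]
  have h1 : ∀ j : ℕ, 2 ≤ j → ∫ t, trig j t = 0 := by
    intro j hj
    refine (integral_unitInterval_of_eq (g := fun x : ℝ =>
      √2 * Real.cos (2 * Real.pi * ((j / 2 : ℕ) : ℤ) * x - phase j)) fun t => ?_).trans ?_
    · rw [trig_eq_cos hj]
      rfl
    rw [intervalIntegral.integral_const_mul, integral_cos_phase,
      if_neg (by omega), mul_zero]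
  have t1 : ∀ t, trig 1 t = 1 := fun t => by simp [trig]
  rcases i with _ | i <;> rcases j with _ | j
  · simp [t1]
  · simpa [t1] using h1 _ (by omega)
  · simpa [t1] using h1 _ (by omega)
  · rw [integral_trig_mul_trig (by omega) (by omega)]
    simp

/-- Completeness comes from the complex Fourier basis: every complex Fourier coefficient of f is a
combination of two real ones, hence zero, and Parseval gives ‖f‖ = 0. -/
theorem eq_zero_of_fourierCoef_eq_zero (f : Signal) (hf : ∀ j, fourierCoef f (j + 1) = 0) :
    f = 0 := by
  set F : ℝ → ℂ := fun x => ((f (Set.projIcc 0 1 zero_le_one x) : ℝ) : ℂ) with hF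
  have hFt : ∀ t : unitInterval, F t = ((f t : ℝ) : ℂ) := fun t => by
    simp only [hF, Set.projIcc_val]
  have hmap : Measure.map (Subtype.val : unitInterval → ℝ) volume
      = (volume : Measure ℝ).restrict (Set.Ioc 0 1) := by
    rw [Measure.restrict_congr_set Ioc_ae_eq_Icc]
    exact map_comap_subtype_coe measurableSet_Icc volume
  have hL2 : MemLp F 2 (volume.restrict (Set.Ioc 0 1)) := by
    rw [← hmap, (MeasurableEmbedding.subtype_coe measurableSet_Icc).memLp_map_measure_iff]
    refine (MemLp.ofReal (K := ℂ) (Lp.memLp f)).ae_eq (Eventually.of_forall fun t => ?_)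
    exact (hFt t).symm
  have hint : ∀ j, Integrable (fun t => f t * trig j t) := fun j => by
    have := (L2.integrable_inner (𝕜 := ℝ) (trigL2 j) f)
    refine this.congr ?_
    filter_upwards [ContinuousMap.coeFn_toLp (p := 2) (𝕜 := ℝ) volume
      (⟨trig j, continuous_trig j⟩ : C(unitInterval, ℝ))] with t h1
    unfold trigL2
    rw [h1]
    simp
  have hcos : ∀ m : ℕ, ∃ u v : ℝ, ∃ j k : ℕ, ∀ t : unitInterval,
      Real.cos (2 * Real.pi * m * t) = u * trig (j + 1) t ∧
      Real.sin (2 * Real.pi * m * t) = v * trig (k + 1) t := by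
    intro m
    rcases m with _ | m
    · exact ⟨1, 0, 0, 0, fun t => by simp [trig]⟩
    · refine ⟨(√2)⁻¹, (√2)⁻¹, 2 * m + 1, 2 * m + 2, fun t => ⟨?_, ?_⟩⟩
      · unfold trig
        rw [if_neg (by omega), if_pos (by rw [Nat.even_iff]; omega),
          show (2 * m + 1 + 1) / 2 = m + 1 by omega, inv_mul_cancel_left₀ (by positivity)]
      · unfold trig
        rw [if_neg (by omega), if_neg (by rw [Nat.even_iff]; omega),
          show (2 * m + 2 + 1) / 2 = m + 1 by omega, inv_mul_cancel_left₀ (by positivity)]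
  have hzero : ∀ j, ∫ t, f t * trig (j + 1) t = 0 := hf
  have hexp : ∀ (m : ℕ) (s : ℝ), ∫ t : unitInterval,
      ((Real.cos (2 * Real.pi * m * t) : ℂ) + s * Complex.I * (Real.sin (2 * Real.pi * m * t) : ℂ))
        * ((f t : ℝ) : ℂ) = 0 := by
    intro m s
    obtain ⟨u, v, j, k, h⟩ := hcos m
    have e : ∀ t : unitInterval, ((Real.cos (2 * Real.pi * m * t) : ℂ) + s * Complex.I *
        (Real.sin (2 * Real.pi * m * t) : ℂ)) * ((f t : ℝ) : ℂ) =
        u * ((f t * trig (j + 1) t : ℝ) : ℂ) + s * Complex.I * v * ((f t * trig (k + 1) t : ℝ) : ℂ) := by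
      intro t
      rw [(h t).1, (h t).2]
      push_cast
      ring
    simp_rw [e]
    rw [integral_add ((hint _).ofReal.const_mul _) ((hint _).ofReal.const_mul _),
      integral_const_mul, integral_const_mul, integral_complex_ofReal, integral_complex_ofReal, hzero, hzero]
    simp
  have hcoef : ∀ n : ℤ, fourierCoeffOn zero_lt_one F n = 0 := by
    intro n
    rw [fourierCoeffOn_eq_integral]
    rw [← integral_unitInterval (fun x : ℝ => fourier (-n) (x : AddCircle ((1 : ℝ) - 0)) • F x)]
    simp only [sub_zero, div_one, one_smul, smul_eq_mul]
    obtain ⟨m, rfl | rfl⟩ := n.eq_nat_or_neg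
    · rw [← hexp m (-1)]
      refine integral_congr_ae (Eventually.of_forall fun t => ?_)
      simp only [hFt]
      congr 1
      rw [fourier_coe_apply]
      rw [show (2 * Real.pi * Complex.I * ((-(m : ℤ) : ℤ) : ℂ) * ((t : ℝ) : ℂ) / ((1 - 0 : ℝ) : ℂ))
        = ((-(2 * Real.pi * m * t) : ℝ) : ℂ) * Complex.I by push_cast; ring, Complex.exp_mul_I]
      rw [← Complex.ofReal_cos, ← Complex.ofReal_sin]
      simp
      ring
    · rw [← hexp m 1]
      refine integral_congr_ae (Eventually.of_forall fun t => ?_)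
      simp only [hFt]
      congr 1
      rw [fourier_coe_apply]
      rw [show (2 * Real.pi * Complex.I * ((-(-(m : ℤ)) : ℤ) : ℂ) * ((t : ℝ) : ℂ) / ((1 - 0 : ℝ) : ℂ))
        = (((2 * Real.pi * m * t) : ℝ) : ℂ) * Complex.I by push_cast; ring, Complex.exp_mul_I]
      rw [← Complex.ofReal_cos, ← Complex.ofReal_sin]
      simp
      ring
  have hpars := tsum_sq_fourierCoeffOn (f := F) (zero_lt_one) hL2
  simp only [hcoef] at hpars
  rw [← integral_unitInterval (fun x => ‖F x‖ ^ 2)] at hpars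
  simp only [hFt] at hpars
  have h0 : ∫ t, f t ^ 2 = 0 := by simpa using hpars.symm
  have : (inner ℝ f f : ℝ) = 0 := by
    rw [L2.inner_def, ← h0]
    refine integral_congr_ae (Eventually.of_forall fun t => ?_)
    simp [sq]
  exact inner_self_eq_zero.mp this

/-- The trigonometric Hilbert basis of `L²[0,1]`; the function at the place `i` is `φ_{i+1}`. -/
def trigBasis : HilbertBasis ℕ ℝ Signal :=
  HilbertBasis.mkOfOrthogonalEqBot orthonormal_trigL2 (by
    rw [Submodule.eq_bot_iff]
    intro f hf
    refine eq_zero_of_fourierCoef_eq_zero f fun j => ?_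
    rw [← inner_trigL2_left]
    exact (Submodule.mem_orthogonal _ _).1 hf _ (Submodule.subset_span ⟨j, rfl⟩))

theorem trigBasis_apply (i : ℕ) : trigBasis i = trigL2 (i + 1) := by
  unfold trigBasis
  rw [HilbertBasis.coe_mkOfOrthogonalEqBot]

theorem hasSum_fourierCoef_sq (f : Signal) :
    HasSum (fun i => fourierCoef f (i + 1) ^ 2) (‖f‖ ^ 2) := by
  have := trigBasis.hasSum_inner_mul_inner f f
  rw [real_inner_self_eq_norm_sq] at this
  have e : (fun i => fourierCoef f (i + 1) ^ 2) =
      fun i => inner ℝ f (trigBasis i) * inner ℝ (trigBasis i) f := by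
    ext i
    rw [real_inner_comm, trigBasis_apply, inner_trigL2_left, sq]
  rwa [e]

/-- Square summability ensures that the `tsum` in `synthesis` is a genuine sum and not the default
value 0. -/
theorem hasSum_synthesis {θ : ℕ → ℝ} (h : Summable fun i => θ i ^ 2) :
    HasSum (fun i => θ i • trigL2 (i + 1)) (synthesis θ) := by
  have hm : Memℓp θ 2 := by
    rw [memℓp_gen_iff (by norm_num)]
    simpa using h
  have := trigBasis.hasSum_repr_symm ⟨θ, hm⟩
  simp only [trigBasis_apply] at this
  exact this.summable.hasSum

theorem fourierCoef_synthesis {θ : ℕ → ℝ} (h : Summable fun i => θ i ^ 2) (j : ℕ) :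
    fourierCoef (synthesis θ) (j + 1) = θ j := by
  rw [← inner_trigL2_left]
  have h1 := (hasSum_synthesis h).mapL (innerSL ℝ (trigL2 (j + 1)))
  refine h1.unique ?_
  have e : (fun i => innerSL ℝ (trigL2 (j + 1)) (θ i • trigL2 (i + 1))) =
      fun i => if i = j then θ j else 0 := by
    ext i
    have := (orthonormal_iff_ite.1 orthonormal_trigL2) j i
    simp only [innerSL_apply_apply, inner_smul_right, this]
    by_cases hij : i = j
    · simp [hij]
    · simp [hij, Ne.symm hij]
  rw [e]
  exact hasSum_ite_eq j (θ j)

/-! ### Step functions and their stochastic integrals -/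

/-- The indicator of `[0, t]` as an element of `L²[0,1]`. -/
def indSignal (t : unitInterval) : Signal :=
  indicatorConstLp 2 (measurableSet_Iic (a := t)) (measure_ne_top volume _) (1 : ℝ)

/-- The step function `∑_t a_t 1_{[0,t]}`. -/
def stepSignal : (unitInterval →₀ ℝ) →ₗ[ℝ] Signal := Finsupp.linearCombination ℝ indSignal

/-- The integral `∑_t a_t y_t` of the step function `∑_t a_t 1_{[0,t]}` against `dy`. -/
def pathIntegral (y : unitInterval → ℝ) : (unitInterval →₀ ℝ) →ₗ[ℝ] ℝ :=
  Finsupp.linearCombination ℝ y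

theorem inner_indSignal (t : unitInterval) (f : Signal) :
    inner ℝ (indSignal t) f = ∫ s in Set.Iic t, f s :=
  L2.inner_indicatorConstLp_one _ _ _

theorem inner_indSignal_indSignal (s t : unitInterval) :
    inner ℝ (indSignal s) (indSignal t) = ((min s t : unitInterval) : ℝ) := by
  unfold indSignal
  rw [L2.real_inner_indicatorConstLp_one_indicatorConstLp_one, Set.Iic_inter_Iic, Measure.real,
    show (s ⊓ t) = min s t from rfl, unitInterval.volume_Iic, ENNReal.toReal_ofReal (min s t).2.1]

theorem norm_stepSignal_sq (a : unitInterval →₀ ℝ) :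
    ‖stepSignal a‖ ^ 2 = ∑ s ∈ a.support, ∑ t ∈ a.support, a s * a t * (min s t : unitInterval) := by
  rw [← real_inner_self_eq_norm_sq]
  unfold stepSignal
  simp only [Finsupp.linearCombination_apply, Finsupp.sum, sum_inner, inner_sum, inner_smul_left,
    inner_smul_right, inner_indSignal_indSignal]
  refine Finset.sum_congr rfl fun s _ => ?_
  rw [Finset.mul_sum]
  refine Finset.sum_congr rfl fun t _ => ?_
  simp [mul_assoc, min_comm]

theorem measurable_pathIntegral (a : unitInterval →₀ ℝ) :
    Measurable fun y : unitInterval → ℝ => pathIntegral y a := by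
  unfold pathIntegral
  simp only [Finsupp.linearCombination_apply, Finsupp.sum]
  fun_prop

theorem pathIntegral_observedPath (n : ℕ) (f : Signal) (w : unitInterval → ℝ)
    (a : unitInterval →₀ ℝ) :
    pathIntegral (observedPath n f w) a =
      inner ℝ (stepSignal a) f + (n : ℝ) ^ (-(1 / 2) : ℝ) * pathIntegral w a := by
  unfold pathIntegral stepSignal observedPath
  simp only [Finsupp.linearCombination_apply, Finsupp.sum, sum_inner, inner_smul_left,
    inner_indSignal, Finset.mul_sum, ← Finset.sum_add_distrib]
  refine Finset.sum_congr rfl fun s _ => ?_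
  simp
  ring

/-- The measures with densities f⁺ and f⁻ agree on all half-lines, hence coincide. This makes the
step functions dense. -/
theorem eq_zero_of_setIntegral_Iic_eq_zero (f : Signal)
    (hf : ∀ t : unitInterval, ∫ s in Set.Iic t, f s = 0) : f = 0 := by
  have hint : Integrable f := (Lp.memLp f).integrable (by norm_num)
  have h : volume.withDensity (fun t => ENNReal.ofReal (f t)) =
      volume.withDensity (fun t => ENNReal.ofReal (-f t)) := by
    have : IsFiniteMeasure (volume.withDensity (fun t => ENNReal.ofReal (f t))) :=
      isFiniteMeasure_withDensity_ofReal hint.2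
    refine Measure.ext_of_Iic _ _ fun t => ?_
    rw [withDensity_apply _ measurableSet_Iic, withDensity_apply _ measurableSet_Iic]
    have h1 := integral_eq_lintegral_pos_part_sub_lintegral_neg_part
      (hint.restrict (s := Set.Iic t))
    rw [hf t] at h1
    have h2 := sub_eq_zero.1 h1.symm
    rwa [ENNReal.toReal_eq_toReal_iff' ] at h2
    · exact (lt_of_le_of_lt (lintegral_mono fun x => Real.ofReal_le_enorm _)
        (hint.restrict (s := Set.Iic t)).2).ne
    · refine (lt_of_le_of_lt (lintegral_mono fun x => ?_)
        (hint.restrict (s := Set.Iic t)).2).ne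
      rw [← enorm_neg]
      exact Real.ofReal_le_enorm _
  rw [withDensity_eq_iff (by fun_prop) (by fun_prop)] at h
  · refine Lp.ext ?_
    filter_upwards [h, Lp.coeFn_zero ℝ 2 (volume : Measure unitInterval)] with t h1 h2
    rw [h2]
    rcases le_total 0 (f t) with h3 | h3
    · rw [ENNReal.ofReal_of_nonpos (by linarith : -f t ≤ 0), ENNReal.ofReal_eq_zero] at h1
      exact le_antisymm h1 h3
    · rw [ENNReal.ofReal_of_nonpos h3, eq_comm, ENNReal.ofReal_eq_zero] at h1
      exact le_antisymm h3 (by simpa using h1)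
  · exact (lt_of_le_of_lt (lintegral_mono fun x => Real.ofReal_le_enorm _) hint.2).ne

theorem exists_stepSignal_near (f : Signal) {ε : ℝ} (hε : 0 < ε) :
    ∃ a, ‖stepSignal a - f‖ < ε := by
  have h : (LinearMap.range stepSignal).topologicalClosure = ⊤ := by
    rw [Submodule.topologicalClosure_eq_top_iff, Submodule.eq_bot_iff]
    intro g hg
    refine eq_zero_of_setIntegral_Iic_eq_zero g fun t => ?_
    rw [← inner_indSignal]
    refine (Submodule.mem_orthogonal _ _).1 hg _ ⟨Finsupp.single t 1, ?_⟩
    simp [stepSignal]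
  have hf : f ∈ closure (Set.range stepSignal) := by
    have : f ∈ (LinearMap.range stepSignal).topologicalClosure := by rw [h]; trivial
    rwa [← SetLike.mem_coe, Submodule.topologicalClosure_coe, LinearMap.coe_range] at this
  obtain ⟨_, ⟨a, rfl⟩, ha⟩ := Metric.mem_closure_iff.1 hf ε hε
  exact ⟨a, by rwa [← dist_eq_norm, dist_comm]⟩

/-- Under the law `μ` on paths, `∑_t a_t w_t` is centered Gaussian with variance
`‖∑_t a_t 1_{[0,t]}‖²`. -/
def IsIsonormal (μ : Measure (unitInterval → ℝ)) : Prop :=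
  ∀ a, HasLaw (fun w => pathIntegral w a) (gaussianReal 0 (‖stepSignal a‖₊ ^ 2)) μ

/-- The Wiener isometry for step functions: the covariance min(s, t) of Brownian motion is the inner
product of the indicators of [0, s] and [0, t]. -/
theorem hasLaw_pathIntegral_of_isPreBrownianReal {Ω : Type*} [MeasurableSpace Ω] {P : Measure Ω}
    {W : ℝ≥0 → Ω → ℝ} (hW : IsPreBrownianReal W P)
    (a : unitInterval →₀ ℝ) :
    HasLaw (fun ω => pathIntegral (fun t => W (unitInterval.toNNReal t) ω) a)
      (gaussianReal 0 (‖stepSignal a‖₊ ^ 2)) P := by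
  set J : Finset ℝ≥0 := a.support.image unitInterval.toNNReal with hJ
  have hP := hW.isGaussianProcess.isProbabilityMeasure
  have hg := hW.isGaussianProcess.hasGaussianLaw J
  let T : a.support → J := fun t => ⟨unitInterval.toNNReal t, Finset.mem_image_of_mem _ t.2⟩
  let L : (J → ℝ) →L[ℝ] ℝ := ∑ t : a.support, a t • ContinuousLinearMap.proj (T t)
  have hL := hg.map_fun L
  have e : (fun ω => L (J.restrict (W · ω))) =
      fun ω => pathIntegral (fun t => W (unitInterval.toNNReal t) ω) a := by
    ext ω
    simp only [L, pathIntegral, Finsupp.linearCombination_apply, Finsupp.sum]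
    rw [← Finset.sum_coe_sort a.support fun t => a t • W (unitInterval.toNNReal t) ω]
    simp [T]
  rw [e] at hL
  have hm : ∀ t, MemLp (W t) 2 P := fun t => (hW.isGaussianProcess.hasGaussianLaw_eval t).memLp_two
  refine ⟨hL.aemeasurable, ?_⟩
  rw [hL.map_eq_gaussianReal]
  have e2 : (fun ω => pathIntegral (fun t => W (unitInterval.toNNReal t) ω) a) =
      fun ω => ∑ t ∈ a.support, a t * W (unitInterval.toNNReal t) ω := by
    ext ω
    simp [pathIntegral, Finsupp.linearCombination_apply, Finsupp.sum]
  have hmean : P[fun ω => pathIntegral (fun t => W (unitInterval.toNNReal t) ω) a] = 0 := by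
    rw [e2, integral_finsetSum _ fun t _ => (hW.integrable_eval _).const_mul _]
    simp [integral_const_mul, hW.integral_eval]
  have hvar : Var[fun ω => pathIntegral (fun t => W (unitInterval.toNNReal t) ω) a; P] =
      ‖stepSignal a‖ ^ 2 := by
    rw [e2, variance_fun_sum' (fun t _ => (hm _).const_mul _), norm_stepSignal_sq]
    refine Finset.sum_congr rfl fun s _ => Finset.sum_congr rfl fun t _ => ?_
    rw [covariance_const_mul_left, covariance_const_mul_right, hW.covariance_fun_eval]
    rw [← mul_assoc]
    congr 1
  rw [hmean, hvar]
  congr 1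
  ext
  simp

theorem isIsonormal_pathLaw {Ω : Type*} [MeasurableSpace Ω] {P : Measure Ω}
    {W : ℝ≥0 → Ω → ℝ} (hW : IsPreBrownianReal W P)
    (hm : AEMeasurable (fun ω (t : unitInterval) => W (unitInterval.toNNReal t) ω) P) :
    IsIsonormal (pathLaw P W) := by
  intro a
  refine ⟨(measurable_pathIntegral a).aemeasurable, ?_⟩
  unfold pathLaw
  rw [AEMeasurable.map_map_of_aemeasurable (measurable_pathIntegral a).aemeasurable hm]
  exact (hasLaw_pathIntegral_of_isPreBrownianReal hW a).map_eq

/-! ### Exponential moments and a chi-square tail bound. -/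

theorem lintegral_exp_mul_gaussianReal (v : ℝ≥0) (t : ℝ) :
    ∫⁻ x, ENNReal.ofReal (Real.exp (t * x)) ∂gaussianReal 0 v =
      ENNReal.ofReal (Real.exp (v * t ^ 2 / 2)) := by
  rw [← ofReal_integral_eq_lintegral_ofReal (integrable_exp_mul_gaussianReal t)
    (Eventually.of_forall fun x => (Real.exp_pos _).le)]
  congr 1
  have := mgf_gaussianReal (p := gaussianReal 0 v) (X := id) (μ := 0) (v := v) (by simp) t
  simpa [mgf] using this

theorem measurable_exp_pathIntegral (b : unitInterval →₀ ℝ) :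
    Measurable fun w : unitInterval → ℝ => ENNReal.ofReal (Real.exp (pathIntegral w b)) :=
  ENNReal.measurable_ofReal.comp (Real.measurable_exp.comp (measurable_pathIntegral b))

theorem lintegral_exp_pathIntegral {μ : Measure (unitInterval → ℝ)} (hμ : IsIsonormal μ)
    (a : unitInterval →₀ ℝ) :
    ∫⁻ w, ENNReal.ofReal (Real.exp (pathIntegral w a)) ∂μ =
      ENNReal.ofReal (Real.exp (‖stepSignal a‖ ^ 2 / 2)) := by
  have h := lintegral_exp_mul_gaussianReal (‖stepSignal a‖₊ ^ 2) 1
  rw [← (hμ a).map_eq, lintegral_map (by fun_prop) (measurable_pathIntegral a)] at h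
  simpa using h

theorem lintegral_exp_sq_gaussianReal :
    ∫⁻ x, ENNReal.ofReal (Real.exp (3 / 8 * x ^ 2)) ∂gaussianReal 0 1 = 2 := by
  rw [gaussianReal_of_var_ne_zero 0 one_ne_zero,
    lintegral_withDensity_eq_lintegral_mul _ (measurable_gaussianPDF 0 1) (by fun_prop)]
  have e : ∀ x : ℝ, (gaussianPDF 0 1 * fun x => ENNReal.ofReal (Real.exp (3 / 8 * x ^ 2))) x =
      ENNReal.ofReal ((√(2 * Real.pi))⁻¹ * Real.exp (-(1 / 8) * x ^ 2)) := by
    intro x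
    simp only [Pi.mul_apply, gaussianPDF, gaussianPDFReal]
    rw [← ENNReal.ofReal_mul (by positivity)]
    congr 1
    rw [mul_assoc, ← Real.exp_add]
    simp only [NNReal.coe_one, mul_one, sub_zero]
    congr 2
    ring
  simp_rw [e]
  rw [← ofReal_integral_eq_lintegral_ofReal
    ((integrable_exp_neg_mul_sq (by norm_num)).const_mul _)
    (Eventually.of_forall fun x => by positivity), integral_const_mul, integral_gaussian]
  have : (√(2 * Real.pi))⁻¹ * √(Real.pi / (1 / 8)) = 2 := by
    rw [← Real.sqrt_inv, ← Real.sqrt_mul (by positivity),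
      show (2 * Real.pi)⁻¹ * (Real.pi / (1 / 8)) = 2 ^ 2 by field_simp; norm_num]
    exact Real.sqrt_sq (by norm_num)
  rw [this]
  simp

theorem IsIsonormal.isProbabilityMeasure {μ : Measure (unitInterval → ℝ)} (hμ : IsIsonormal μ) :
    IsProbabilityMeasure μ := (hμ 0).isProbabilityMeasure

/-- The square is linearised by auxiliary independent standard normals c_i: exp(x²/4) = E exp(c
x/√2). After exchanging the integrals the exponent is linear in the path, so only the
one-dimensional laws in `IsIsonormal` are needed. The norm bound then leaves the moments E
exp(3c_i²/8) = 2. The step functions need only be nearly orthonormal. -/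
theorem lintegral_exp_sum_sq_le {μ : Measure (unitInterval → ℝ)} (hμ : IsIsonormal μ)
    (J : ℕ) (a : ℕ → unitInterval →₀ ℝ)
    (ha : ∀ c : ℕ → ℝ, ‖∑ i ∈ Finset.range J, c i • stepSignal (a i)‖ ^ 2 ≤
      3 / 2 * ∑ i ∈ Finset.range J, c i ^ 2) :
    ∫⁻ w, ENNReal.ofReal (Real.exp ((∑ i ∈ Finset.range J, pathIntegral w (a i) ^ 2) / 4)) ∂μ
      ≤ 2 ^ J := by
  have := hμ.isProbabilityMeasure
  set γ : Measure (ℕ → ℝ) := Measure.infinitePi fun _ : ℕ => gaussianReal 0 1 with hγ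
  have hprod : ∀ F : ℕ → ℝ → ℝ≥0∞, (∀ i, Measurable (F i)) →
      ∫⁻ c, ∏ i ∈ Finset.range J, F i (c i) ∂γ =
        ∏ i ∈ Finset.range J, ∫⁻ x, F i x ∂gaussianReal 0 1 := by
    intro F hF
    rw [lintegral_prod_eq_prod_lintegral_of_indepFun (Finset.range J) (fun i (c : ℕ → ℝ) => F i (c i))
      (iIndepFun_infinitePi hF) (fun i => (hF i).comp (measurable_pi_apply i))]
    refine Finset.prod_congr rfl fun i _ => ?_
    rw [← lintegral_map (hF i) (measurable_pi_apply i)]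
    exact congrArg (fun ρ => ∫⁻ x, F i x ∂ρ) (Measure.infinitePi_map_eval _ i)
  have h1 : ∀ w, ENNReal.ofReal
      (Real.exp ((∑ i ∈ Finset.range J, pathIntegral w (a i) ^ 2) / 4)) =
      ∫⁻ c, ENNReal.ofReal (Real.exp (pathIntegral w
        (∑ i ∈ Finset.range J, ((√2)⁻¹ * c i) • a i))) ∂γ := by
    intro w
    have e : ∀ c : ℕ → ℝ, ENNReal.ofReal (Real.exp (pathIntegral w
        (∑ i ∈ Finset.range J, ((√2)⁻¹ * c i) • a i))) =
        ∏ i ∈ Finset.range J, ENNReal.ofReal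
          (Real.exp (((√2)⁻¹ * pathIntegral w (a i)) * c i)) := by
      intro c
      rw [← ENNReal.ofReal_prod_of_nonneg fun _ _ => (Real.exp_pos _).le, ← Real.exp_sum, map_sum]
      congr 2
      refine Finset.sum_congr rfl fun i _ => ?_
      rw [map_smul, smul_eq_mul]
      ring
    simp_rw [e]
    rw [hprod (fun i x => ENNReal.ofReal (Real.exp (((√2)⁻¹ * pathIntegral w (a i)) * x)))
      (fun i => by fun_prop), Finset.sum_div, Real.exp_sum,
      ENNReal.ofReal_prod_of_nonneg fun _ _ => (Real.exp_pos _).le]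
    refine Finset.prod_congr rfl fun i _ => ?_
    rw [lintegral_exp_mul_gaussianReal, mul_pow, inv_pow, Real.sq_sqrt (by norm_num)]
    congr 2
    simp
    ring
  simp_rw [h1]
  rw [lintegral_lintegral_swap]
  · calc ∫⁻ c, ∫⁻ w, ENNReal.ofReal (Real.exp (pathIntegral w
          (∑ i ∈ Finset.range J, ((√2)⁻¹ * c i) • a i))) ∂μ ∂γ
        ≤ ∫⁻ c, ∏ i ∈ Finset.range J, ENNReal.ofReal (Real.exp (3 / 8 * c i ^ 2)) ∂γ := by
          refine lintegral_mono fun c => ?_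
          rw [lintegral_exp_pathIntegral hμ,
            ← ENNReal.ofReal_prod_of_nonneg fun _ _ => (Real.exp_pos _).le, ← Real.exp_sum]
          refine ENNReal.ofReal_le_ofReal (Real.exp_le_exp.2 ?_)
          have := ha fun i => (√2)⁻¹ * c i
          rw [map_sum]
          simp_rw [map_smul]
          simp_rw [mul_pow, inv_pow, Real.sq_sqrt (show (0 : ℝ) ≤ 2 by norm_num)] at this
          rw [← Finset.mul_sum] at this ⊢
          linarith
      _ = 2 ^ J := by
          rw [hprod (fun _ x => ENNReal.ofReal (Real.exp (3 / 8 * x ^ 2))) (fun i => by fun_prop)]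
          simp [lintegral_exp_sq_gaussianReal]
  · refine Measurable.aemeasurable ?_
    refine ENNReal.measurable_ofReal.comp (Real.measurable_exp.comp ?_)
    simp only [map_sum, map_smul, smul_eq_mul]
    refine Finset.measurable_sum _ fun i _ => ?_
    exact (((measurable_pi_apply i).comp measurable_snd).const_mul _).mul
      ((measurable_pathIntegral (a i)).comp measurable_fst)

theorem measure_sum_sq_gt_le {μ : Measure (unitInterval → ℝ)} (hμ : IsIsonormal μ)
    (J : ℕ) (a : ℕ → unitInterval →₀ ℝ)
    (ha : ∀ c : ℕ → ℝ, ‖∑ i ∈ Finset.range J, c i • stepSignal (a i)‖ ^ 2 ≤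
      3 / 2 * ∑ i ∈ Finset.range J, c i ^ 2) (x : ℝ) :
    μ {w | x ≤ ∑ i ∈ Finset.range J, pathIntegral w (a i) ^ 2} ≤
      ENNReal.ofReal (Real.exp (J - x / 4)) := by
  have h := lintegral_exp_sum_sq_le hμ J a ha
  have hm : Measurable fun w : unitInterval → ℝ =>
      ENNReal.ofReal (Real.exp ((∑ i ∈ Finset.range J, pathIntegral w (a i) ^ 2) / 4)) := by
    refine ENNReal.measurable_ofReal.comp (Real.measurable_exp.comp (Measurable.div_const ?_ _))
    exact Finset.measurable_sum _ fun i _ => (measurable_pathIntegral (a i)).pow_const 2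
  have h2 := (mul_meas_ge_le_lintegral hm (ENNReal.ofReal (Real.exp (x / 4)))).trans h
  have h3 : (2 : ℝ≥0∞) ^ J ≤ ENNReal.ofReal (Real.exp J) := by
    have : (2 : ℝ) ^ J ≤ Real.exp J := by
      rw [← Real.exp_one_pow]
      exact pow_le_pow_left₀ (by norm_num) (by linarith [Real.add_one_le_exp (1 : ℝ)]) J
    calc (2 : ℝ≥0∞) ^ J = ENNReal.ofReal (2 ^ J) := by
          rw [ENNReal.ofReal_pow (by norm_num)]; simp
      _ ≤ _ := ENNReal.ofReal_le_ofReal this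
  calc μ {w | x ≤ ∑ i ∈ Finset.range J, pathIntegral w (a i) ^ 2}
      ≤ μ {w | ENNReal.ofReal (Real.exp (x / 4)) ≤ ENNReal.ofReal
          (Real.exp ((∑ i ∈ Finset.range J, pathIntegral w (a i) ^ 2) / 4))} := by
        refine measure_mono fun w hw => ENNReal.ofReal_le_ofReal (Real.exp_le_exp.2 ?_)
        simp only [Set.mem_ofPred_eq] at hw
        linarith
    _ = ENNReal.ofReal (Real.exp (-(x / 4))) * (ENNReal.ofReal (Real.exp (x / 4)) *
        μ {w | ENNReal.ofReal (Real.exp (x / 4)) ≤ ENNReal.ofReal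
          (Real.exp ((∑ i ∈ Finset.range J, pathIntegral w (a i) ^ 2) / 4))}) := by
        rw [← mul_assoc, ← ENNReal.ofReal_mul (Real.exp_pos _).le, ← Real.exp_add]
        simp
    _ ≤ ENNReal.ofReal (Real.exp (-(x / 4))) * ENNReal.ofReal (Real.exp J) := by
        gcongr
        exact h2.trans h3
    _ = ENNReal.ofReal (Real.exp (J - x / 4)) := by
        rw [← ENNReal.ofReal_mul (Real.exp_pos _).le, ← Real.exp_add]
        ring_nf

/-! ### The Cameron–Martin inequality -/

/-- A moment generating function that is finite on the whole line extends to an entire function,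
which determines the law. -/
theorem map_eq_gaussianReal_of_lintegral_exp {Ω : Type*} [MeasurableSpace Ω] {ν : Measure Ω}
    [IsFiniteMeasure ν] {X : Ω → ℝ} (hX : AEMeasurable X ν) (m : ℝ) (v : ℝ≥0)
    (h : ∀ t : ℝ, ∫⁻ ω, ENNReal.ofReal (Real.exp (t * X ω)) ∂ν =
      ENNReal.ofReal (Real.exp (m * t + v * t ^ 2 / 2))) :
    ν.map X = gaussianReal m v := by
  have hmgf : mgf id (gaussianReal m v) = mgf X ν := by
    ext t
    rw [mgf_gaussianReal (p := gaussianReal m v) (X := id) (μ := m) (v := v) (by simp), mgf,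
      integral_eq_lintegral_of_nonneg_ae (Eventually.of_forall fun ω => (Real.exp_pos _).le)
        (by fun_prop), h, ENNReal.toReal_ofReal (Real.exp_pos _).le]
  have h2 := eqOn_complexMGF_of_mgf hmgf
  rw [integrableExpSet_id_gaussianReal] at h2
  have h3 : complexMGF id (gaussianReal m v) = complexMGF X ν := by
    ext z
    exact h2 (by simp)
  simpa using (Measure.ext_of_complexMGF_eq aemeasurable_id hX h3).symm

/-- The primitive `t ↦ ∫_0^t f` of a signal. -/
def drift (f : Signal) (t : unitInterval) : ℝ := ∫ s in Set.Iic t, f s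

theorem inner_stepSignal (a : unitInterval →₀ ℝ) (f : Signal) :
    inner ℝ (stepSignal a) f = pathIntegral (drift f) a := by
  unfold stepSignal pathIntegral drift
  simp only [Finsupp.linearCombination_apply, Finsupp.sum, sum_inner, inner_smul_left,
    inner_indSignal]
  simp

theorem pathIntegral_add (w v : unitInterval → ℝ) (a : unitInterval →₀ ℝ) :
    pathIntegral (w + v) a = pathIntegral w a + pathIntegral v a := by
  unfold pathIntegral
  simp [Finsupp.linearCombination_apply, Finsupp.sum, mul_add, Finset.sum_add_distrib]

/-- The Cameron–Martin density of the shift by the primitive of a step function. -/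
def shiftDensity (a : unitInterval →₀ ℝ) (w : unitInterval → ℝ) : ℝ≥0∞ :=
  ENNReal.ofReal (Real.exp (pathIntegral w a - ‖stepSignal a‖ ^ 2 / 2))

theorem measurable_shiftDensity (a : unitInterval →₀ ℝ) : Measurable (shiftDensity a) :=
  ENNReal.measurable_ofReal.comp (Real.measurable_exp.comp
    ((measurable_pathIntegral a).sub_const _))

/-- The exponents add up to the path integral of `b + a`, and expanding ‖b + a‖² leaves the
exponential moment of a Gaussian with mean ⟨b, a⟩: the density shifts the mean and keeps the
variance. -/
theorem lintegral_exp_withDensity_shiftDensity {μ : Measure (unitInterval → ℝ)}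
    (hμ : IsIsonormal μ) (a b : unitInterval →₀ ℝ) :
    ∫⁻ w, ENNReal.ofReal (Real.exp (pathIntegral w b)) ∂(μ.withDensity (shiftDensity a)) =
      ENNReal.ofReal (Real.exp (inner ℝ (stepSignal b) (stepSignal a) +
        ‖stepSignal b‖ ^ 2 / 2)) := by
  rw [lintegral_withDensity_eq_lintegral_mul _ (measurable_shiftDensity a)
    (measurable_exp_pathIntegral b)]
  have e : ∀ w, (shiftDensity a * fun w => ENNReal.ofReal (Real.exp (pathIntegral w b))) w =
      ENNReal.ofReal (Real.exp (-(‖stepSignal a‖ ^ 2 / 2))) *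
        ENNReal.ofReal (Real.exp (pathIntegral w (b + a))) := by
    intro w
    simp only [Pi.mul_apply, shiftDensity]
    rw [← ENNReal.ofReal_mul (Real.exp_pos _).le, ← ENNReal.ofReal_mul (Real.exp_pos _).le,
      ← Real.exp_add, ← Real.exp_add, map_add]
    congr 2
    ring
  simp_rw [e]
  rw [lintegral_const_mul _ (measurable_exp_pathIntegral (b + a)), lintegral_exp_pathIntegral hμ,
    ← ENNReal.ofReal_mul (Real.exp_pos _).le, ← Real.exp_add, map_add, norm_add_sq_real]
  congr 2
  ring

theorem isProbabilityMeasure_withDensity_shiftDensity {μ : Measure (unitInterval → ℝ)}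
    (hμ : IsIsonormal μ) (a : unitInterval →₀ ℝ) :
    IsProbabilityMeasure (μ.withDensity (shiftDensity a)) :=
  ⟨by simpa using lintegral_exp_withDensity_shiftDensity hμ a 0⟩

theorem exists_pathIntegral_eq (I : Finset unitInterval) (L : StrongDual ℝ (I → ℝ)) :
    ∃ b, ∀ w : unitInterval → ℝ, L (I.restrict w) = pathIntegral w b := by
  refine ⟨∑ i : I, Finsupp.single (i : unitInterval) (L (Pi.single i 1)), fun w => ?_⟩
  rw [map_sum]
  have : (L : (I → ℝ) →ₗ[ℝ] ℝ) (I.restrict w) = _ :=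
    LinearMap.pi_apply_eq_sum_univ (L : (I → ℝ) →ₗ[ℝ] ℝ) (I.restrict w)
  simp only [ContinuousLinearMap.coe_coe] at this
  rw [this]
  refine Finset.sum_congr rfl fun i _ => ?_
  simp only [pathIntegral, Finsupp.linearCombination_single, smul_eq_mul, Finset.restrict]
  rw [mul_comm]
  congr 2
  ext j
  simp [Pi.single_apply, eq_comm]

theorem measurable_add_drift (f : Signal) :
    Measurable fun w : unitInterval → ℝ => w + drift f := measurable_id.add_const _

theorem map_restrict_withDensity_shiftDensity {μ : Measure (unitInterval → ℝ)}
    (hμ : IsIsonormal μ) (a : unitInterval →₀ ℝ) (I : Finset unitInterval) :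
    (μ.withDensity (shiftDensity a)).map I.restrict =
      (μ.map fun w => w + drift (stepSignal a)).map I.restrict := by
  have := hμ.isProbabilityMeasure
  have := isProbabilityMeasure_withDensity_shiftDensity hμ a
  have hr : Measurable (I.restrict : (unitInterval → ℝ) → I → ℝ) := Finset.measurable_restrict I
  have hd := measurable_add_drift (stepSignal a)
  have := Measure.isProbabilityMeasure_map (μ := μ) hd.aemeasurable
  refine Measure.ext_of_charFunDual (funext fun L => ?_)
  rw [charFunDual_eq_charFun_map_one, charFunDual_eq_charFun_map_one,
    Measure.map_map (by fun_prop) hr, Measure.map_map (by fun_prop) hr]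
  obtain ⟨b, hb⟩ := exists_pathIntegral_eq I L
  have e : (L ∘ I.restrict : (unitInterval → ℝ) → ℝ) = fun w => pathIntegral w b := funext hb
  rw [e]
  congr 1
  have hm := measurable_pathIntegral b
  have hv : ((‖stepSignal b‖₊ ^ 2 : ℝ≥0) : ℝ) = ‖stepSignal b‖ ^ 2 := by simp
  rw [map_eq_gaussianReal_of_lintegral_exp hm.aemeasurable
    (inner ℝ (stepSignal b) (stepSignal a)) (‖stepSignal b‖₊ ^ 2) fun t => ?_, Measure.map_map hm hd]
  · symm
    refine map_eq_gaussianReal_of_lintegral_exp (hm.comp hd).aemeasurable _ _ fun t => ?_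
    have e2 : ∀ w, ENNReal.ofReal (Real.exp (t * ((fun w => pathIntegral w b) ∘
        fun w => w + drift (stepSignal a)) w)) =
        ENNReal.ofReal (Real.exp (t * inner ℝ (stepSignal b) (stepSignal a))) *
          ENNReal.ofReal (Real.exp (pathIntegral w (t • b))) := by
      intro w
      rw [← ENNReal.ofReal_mul (Real.exp_pos _).le, ← Real.exp_add, inner_stepSignal, map_smul]
      simp only [Function.comp_apply, pathIntegral_add, smul_eq_mul]
      congr 2
      ring
    simp_rw [e2]
    rw [lintegral_const_mul _ (measurable_exp_pathIntegral _), lintegral_exp_pathIntegral hμ,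
      ← ENNReal.ofReal_mul (Real.exp_pos _).le, ← Real.exp_add, map_smul, norm_smul, mul_pow, hv]
    congr 2
    simp
    ring
  · have := lintegral_exp_withDensity_shiftDensity hμ a (t • b)
    simp only [map_smul, smul_eq_mul, inner_smul_left, norm_smul, mul_pow] at this
    rw [this, hv]
    congr 2
    simp
    ring

/-- Cauchy–Schwarz: with density e^ℓ, μ(A) = ∫_A e^{ℓ/2} e^{-ℓ/2}, and ∫ e^{-ℓ} dμ = exp(‖h‖²) for
the step function h. -/
theorem sq_measure_le_withDensity {μ : Measure (unitInterval → ℝ)} (hμ : IsIsonormal μ)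
    (a : unitInterval →₀ ℝ) {A : Set (unitInterval → ℝ)} (hA : MeasurableSet A) :
    μ A ^ 2 ≤ ENNReal.ofReal (Real.exp (‖stepSignal a‖ ^ 2)) *
      μ.withDensity (shiftDensity a) A := by
  set ℓ : (unitInterval → ℝ) → ℝ := fun w => pathIntegral w a - ‖stepSignal a‖ ^ 2 / 2 with hℓ
  have hm : Measurable ℓ := (measurable_pathIntegral a).sub_const _
  set F : (unitInterval → ℝ) → ℝ≥0∞ := A.indicator fun w => ENNReal.ofReal (Real.exp (ℓ w / 2))
    with hF
  set G : (unitInterval → ℝ) → ℝ≥0∞ := fun w => ENNReal.ofReal (Real.exp (-(ℓ w / 2))) with hG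
  have hFm : Measurable F := Measurable.indicator (by fun_prop) hA
  have hGm : Measurable G := by fun_prop
  have h := ENNReal.lintegral_mul_le_Lp_mul_Lq μ Real.HolderConjugate.two_two hFm.aemeasurable
    hGm.aemeasurable
  have h1 : ∫⁻ w, (F * G) w ∂μ = μ A := by
    rw [← lintegral_indicator_one hA]
    refine lintegral_congr fun w => ?_
    simp only [hF, hG, Pi.mul_apply]
    by_cases hw : w ∈ A
    · rw [Set.indicator_of_mem hw, Set.indicator_of_mem hw, ← ENNReal.ofReal_mul (Real.exp_pos _).le, ← Real.exp_add]
      simp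
    · simp [hw]
  have h2 : ∫⁻ w, F w ^ (2 : ℝ) ∂μ = μ.withDensity (shiftDensity a) A := by
    rw [withDensity_apply _ hA, ← lintegral_indicator hA]
    refine lintegral_congr fun w => ?_
    simp only [hF]
    by_cases hw : w ∈ A
    · rw [Set.indicator_of_mem hw, Set.indicator_of_mem hw, ENNReal.rpow_two, ← ENNReal.ofReal_pow (Real.exp_pos _).le, ← Real.exp_nat_mul,
        shiftDensity]
      congr 2
      simp only [hℓ]
      push_cast
      ring
    · simp [hw]
  have h3 : ∫⁻ w, G w ^ (2 : ℝ) ∂μ = ENNReal.ofReal (Real.exp (‖stepSignal a‖ ^ 2)) := by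
    have e : ∀ w, G w ^ (2 : ℝ) = ENNReal.ofReal (Real.exp (‖stepSignal a‖ ^ 2 / 2)) *
        ENNReal.ofReal (Real.exp (pathIntegral w (-a))) := by
      intro w
      rw [ENNReal.rpow_two, ← ENNReal.ofReal_pow (Real.exp_pos _).le, ← Real.exp_nat_mul,
        ← ENNReal.ofReal_mul (Real.exp_pos _).le, ← Real.exp_add, map_neg]
      congr 2
      simp only [hℓ]
      push_cast
      ring
    simp_rw [e]
    rw [lintegral_const_mul _ (measurable_exp_pathIntegral _), lintegral_exp_pathIntegral hμ,
      ← ENNReal.ofReal_mul (Real.exp_pos _).le, ← Real.exp_add, map_neg, norm_neg]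
    congr 2
    ring
  rw [h1, h2, h3] at h
  calc μ A ^ 2 ≤ ((μ.withDensity (shiftDensity a) A) ^ (1 / (2 : ℝ)) *
        ENNReal.ofReal (Real.exp (‖stepSignal a‖ ^ 2)) ^ (1 / (2 : ℝ))) ^ 2 := by gcongr
    _ = _ := by
      rw [mul_pow, ← ENNReal.rpow_natCast, ← ENNReal.rpow_natCast, ← ENNReal.rpow_mul,
        ← ENNReal.rpow_mul]
      norm_num
      rw [mul_comm]

/-- The step function is the orthogonal projection of h onto the span of the indicators of [0, t], t
∈ I. Finitely many coordinates of a path cannot tell the two drifts apart, and projecting does not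
increase the norm. -/
theorem exists_stepSignal_inner_eq (h : Signal) (I : Finset unitInterval) :
    ∃ a, ‖stepSignal a‖ ≤ ‖h‖ ∧ ∀ t ∈ I, drift (stepSignal a) t = drift h t := by
  set K : Submodule ℝ Signal := Submodule.span ℝ (indSignal '' (I : Set unitInterval)) with hK
  have : FiniteDimensional ℝ K :=
    FiniteDimensional.span_of_finite ℝ (I.finite_toSet.image indSignal)
  have hp : K.starProjection h ∈ K := Submodule.starProjection_apply_mem K h
  obtain ⟨a, -, ha⟩ := (Finsupp.mem_span_image_iff_linearCombination ℝ).1 hp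
  have ha' : stepSignal a = K.starProjection h := ha
  refine ⟨a, ?_, fun t ht => ?_⟩
  · rw [ha']
    exact Submodule.norm_starProjection_apply_le K h
  · have hmem : indSignal t ∈ K := Submodule.subset_span ⟨t, ht, rfl⟩
    unfold drift
    rw [← inner_indSignal, ← inner_indSignal, ha', ← sub_eq_zero, ← inner_sub_right,
      ← neg_eq_zero, ← inner_neg_right, neg_sub]
    exact Submodule.sub_starProjection_mem_orthogonal (K := K) h _ hmem

/-- For a cylinder set h may be replaced by a step function without loss. Both sides are continuous
under approximation in measure, so the inequality passes to all measurable sets, and no density is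
needed for a general shift. -/
theorem sq_measure_le_map_add_drift {μ : Measure (unitInterval → ℝ)} (hμ : IsIsonormal μ)
    (h : Signal) {A : Set (unitInterval → ℝ)} (hA : MeasurableSet A) :
    μ A ^ 2 ≤ ENNReal.ofReal (Real.exp (‖h‖ ^ 2)) * μ.map (fun w => w + drift h) A := by
  have := hμ.isProbabilityMeasure
  have hd := measurable_add_drift h
  set ν := μ.map (fun w => w + drift h) with hν
  have : IsProbabilityMeasure ν := Measure.isProbabilityMeasure_map (μ := μ) hd.aemeasurable
  set C := ENNReal.ofReal (Real.exp (‖h‖ ^ 2)) with hC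
  have hcyl : ∀ D ∈ measurableCylinders (fun _ : unitInterval => ℝ), μ D ^ 2 ≤ C * ν D := by
    intro D hD
    obtain ⟨I, S, hS, rfl⟩ := (mem_measurableCylinders _).1 hD
    obtain ⟨a, ha, hat⟩ := exists_stepSignal_inner_eq h I
    have hr : Measurable (I.restrict : (unitInterval → ℝ) → I → ℝ) := Finset.measurable_restrict I
    refine (sq_measure_le_withDensity hμ a (hS.cylinder I)).trans ?_
    have e : μ.withDensity (shiftDensity a) (cylinder I S) = ν (cylinder I S) := by
      have e1 := congrArg (fun ρ => ρ S) (map_restrict_withDensity_shiftDensity hμ a I)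
      simp only [Measure.map_apply hr hS] at e1
      rw [cylinder, e1, hν, Measure.map_apply (measurable_add_drift _) (hr hS),
        Measure.map_apply hd (hr hS)]
      congr 1
      ext w
      simp only [Set.mem_preimage]
      have : I.restrict (w + drift (stepSignal a)) = I.restrict (w + drift h) := by
        ext t
        simp [Finset.restrict, hat t t.2]
      rw [this]
    rw [e, hC]
    gcongr
  -- Density with respect to the sum gives one cylinder set that approximates `A` under both
  -- measures.
  have hdense := Measure.MeasureDense.of_generateFrom_isSetAlgebra_finite (μ + ν)
    (isSetAlgebra_measurableCylinders (α := fun _ : unitInterval => ℝ))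
    generateFrom_measurableCylinders.symm
  have key : ∀ ε : ℝ, 0 < ε →
      μ A ^ 2 ≤ C * ν A + (C * ENNReal.ofReal ε + 2 * ENNReal.ofReal ε) := by
    intro ε hε
    obtain ⟨D, hD, hAD⟩ := hdense.approx A hA (measure_ne_top _ _) ε hε
    have h1 : μ A ≤ μ D + ENNReal.ofReal ε := by
      refine (measure_mono (t := D ∪ symmDiff A D) fun w hw => ?_).trans
        ((measure_union_le _ _).trans ?_)
      · by_cases hwD : w ∈ D
        · exact Or.inl hwD
        · exact Or.inr (Or.inl ⟨hw, hwD⟩)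
      · gcongr
        exact (Measure.le_iff'.1 (Measure.le_add_right le_rfl) _).trans hAD.le
    have h2 : ν D ≤ ν A + ENNReal.ofReal ε := by
      refine (measure_mono (t := A ∪ symmDiff A D) fun w hw => ?_).trans
        ((measure_union_le _ _).trans ?_)
      · by_cases hwA : w ∈ A
        · exact Or.inl hwA
        · exact Or.inr (Or.inr ⟨hw, hwA⟩)
      · gcongr
        exact (Measure.le_iff'.1 (Measure.le_add_left le_rfl) _).trans hAD.le
    calc μ A ^ 2 = μ A * μ A := sq _
      _ ≤ (μ D + ENNReal.ofReal ε) * μ A := by gcongr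
      _ = μ D * μ A + ENNReal.ofReal ε * μ A := add_mul _ _ _
      _ ≤ μ D * (μ D + ENNReal.ofReal ε) + ENNReal.ofReal ε * 1 := by
          gcongr
          exact prob_le_one
      _ = μ D ^ 2 + (μ D * ENNReal.ofReal ε + ENNReal.ofReal ε * 1) := by ring
      _ ≤ C * (ν A + ENNReal.ofReal ε) + (1 * ENNReal.ofReal ε + ENNReal.ofReal ε * 1) := by
          gcongr
          · exact (hcyl D hD).trans (by gcongr)
          · exact prob_le_one
      _ = _ := by ring
  have hlim : Tendsto (fun ε : ℝ => C * ν A + (C * ENNReal.ofReal ε + 2 * ENNReal.ofReal ε))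
      (𝓝[>] 0) (𝓝 (C * ν A + (C * ENNReal.ofReal 0 + 2 * ENNReal.ofReal 0))) := by
    refine tendsto_const_nhds.add (Tendsto.add ?_ ?_)
    · exact ENNReal.Tendsto.const_mul
        ((ENNReal.continuous_ofReal.tendsto 0).mono_left nhdsWithin_le_nhds)
        (Or.inr ENNReal.ofReal_ne_top)
    · exact ENNReal.Tendsto.const_mul
        ((ENNReal.continuous_ofReal.tendsto 0).mono_left nhdsWithin_le_nhds)
        (Or.inr (by simp))
  simp only [ENNReal.ofReal_zero, mul_zero, add_zero] at hlim
  exact ge_of_tendsto hlim (by filter_upwards [self_mem_nhdsWithin] with ε hε using key ε hε)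

/-! ### Two-point inequality and tests in the white noise model -/

theorem whiteNoise_apply {Ω : Type*} [MeasurableSpace Ω] (P : Measure Ω) [IsProbabilityMeasure P]
    (W : ℝ≥0 → Ω → ℝ) (n : ℕ) (f : Signal) {D : Set (unitInterval → ℝ)} (hD : MeasurableSet D) :
    whiteNoise P W n f D = pathLaw P W {w | observedPath n f w ∈ D} :=
  Measure.map_apply (measurable_observedPath_right n f) hD

theorem natCast_rpow_neg_half {n : ℕ} : (n : ℝ) ^ (-(1 / 2) : ℝ) = (√(n : ℝ))⁻¹ := by
  rw [Real.rpow_neg (Nat.cast_nonneg n), Real.sqrt_eq_rpow]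

theorem drift_add (f g : Signal) (t : unitInterval) : drift (f + g) t = drift f t + drift g t := by
  simp only [drift, ← inner_indSignal, inner_add_right]

theorem drift_smul (c : ℝ) (f : Signal) (t : unitInterval) : drift (c • f) t = c * drift f t := by
  simp only [drift, ← inner_indSignal, inner_smul_right]

theorem observedPath_add_drift {n : ℕ} (hn : 0 < n) (f g : Signal) (w : unitInterval → ℝ) :
    observedPath n f (w + drift (√(n : ℝ) • g)) = observedPath n (f + g) w := by
  have h : √(n : ℝ) ≠ 0 := by positivity
  ext t
  change drift f t + (n : ℝ) ^ (-(1 / 2) : ℝ) * (w t + drift (√(n : ℝ) • g) t) =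
    drift (f + g) t + (n : ℝ) ^ (-(1 / 2) : ℝ) * w t
  rw [drift_add, drift_smul, natCast_rpow_neg_half]
  field_simp
  ring

/-- Changing the signal from f₀ to f amounts to shifting the noise by the primitive of √n (f - f₀),
which has squared norm n‖f - f₀‖². -/
theorem sq_whiteNoise_le {Ω : Type*} [MeasurableSpace Ω] {P : Measure Ω} [IsProbabilityMeasure P]
    {W : ℝ≥0 → Ω → ℝ} (hμ : IsIsonormal (pathLaw P W)) {n : ℕ} (hn : 0 < n) (f₀ f : Signal)
    {D : Set (unitInterval → ℝ)} (hD : MeasurableSet D) :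
    whiteNoise P W n f₀ D ^ 2 ≤
      ENNReal.ofReal (Real.exp (n * ‖f - f₀‖ ^ 2)) * whiteNoise P W n f D := by
  rw [whiteNoise_apply P W n f₀ hD, whiteNoise_apply P W n f hD]
  have hD' : MeasurableSet {w | observedPath n f₀ w ∈ D} := measurable_observedPath_right n f₀ hD
  refine (sq_measure_le_map_add_drift hμ (√(n : ℝ) • (f - f₀)) hD').trans_eq ?_
  rw [Measure.map_apply (measurable_add_drift _) hD', norm_smul, mul_pow, Real.norm_eq_abs, sq_abs,
    Real.sq_sqrt (Nat.cast_nonneg n)]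
  congr 2
  ext w
  simp only [Set.mem_preimage, Set.mem_ofPred_eq]
  rw [observedPath_add_drift hn, add_sub_cancel]

/-- Only step functions can be integrated against a path, so the first `J` basis functions are
replaced by step functions so close to them that they remain nearly orthonormal and nearly reproduce
the Fourier energy. -/
theorem exists_stepSignals_near_trig (J : ℕ) :
    ∃ a : ℕ → unitInterval →₀ ℝ,
      (∀ c : ℕ → ℝ, ‖∑ i ∈ Finset.range J, c i • stepSignal (a i)‖ ^ 2 ≤
        3 / 2 * ∑ i ∈ Finset.range J, c i ^ 2) ∧
      ∀ g : Signal, ∑ i ∈ Finset.range J, fourierCoef g (i + 1) ^ 2 ≤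
        2 * ∑ i ∈ Finset.range J, inner ℝ (stepSignal (a i)) g ^ 2 + ‖g‖ ^ 2 / 32 := by
  -- This gives Jη² ≤ 1/64. The perturbation of a combination then has norm at most 1/8 of the main
  -- term, with (9/8)² ≤ 3/2, and the energy error 2Jη²‖g‖² is at most ‖g‖²/32.
  set η : ℝ := (8 * ((J : ℝ) + 1))⁻¹ with hη
  have hη0 : 0 < η := by positivity
  have hηJ : J * η ≤ 1 / 8 := by
    rw [hη, ← div_eq_mul_inv, div_le_iff₀ (by positivity)]
    linarith
  have hη1 : η ≤ 1 / 8 := by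
    rw [hη, one_div]
    apply inv_anti₀ (by norm_num)
    linarith [(Nat.cast_nonneg J : (0 : ℝ) ≤ J)]
  have hηJ2 : J * η ^ 2 ≤ 1 / 64 := by
    nlinarith [(Nat.cast_nonneg J : (0 : ℝ) ≤ J)]
  choose a ha using fun i : ℕ => exists_stepSignal_near (trigL2 (i + 1)) hη0
  refine ⟨a, fun c => ?_, fun g => ?_⟩
  · have e : ∑ i ∈ Finset.range J, c i • stepSignal (a i) =
        ∑ i ∈ Finset.range J, c i • trigL2 (i + 1) +
          ∑ i ∈ Finset.range J, c i • (stepSignal (a i) - trigL2 (i + 1)) := by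
      rw [← Finset.sum_add_distrib]
      refine Finset.sum_congr rfl fun i _ => ?_
      rw [smul_sub, add_sub_cancel]
    have hA : ‖∑ i ∈ Finset.range J, c i • trigL2 (i + 1)‖ ^ 2 = ∑ i ∈ Finset.range J, c i ^ 2 := by
      rw [← real_inner_self_eq_norm_sq,
        orthonormal_trigL2.inner_sum (fun i => c i) (fun i => c i) (Finset.range J)]
      simp [sq]
    have hB : ‖∑ i ∈ Finset.range J, c i • (stepSignal (a i) - trigL2 (i + 1))‖ ^ 2 ≤
        1 / 64 * ∑ i ∈ Finset.range J, c i ^ 2 := by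
      have h1 : ‖∑ i ∈ Finset.range J, c i • (stepSignal (a i) - trigL2 (i + 1))‖ ≤
          η * ∑ i ∈ Finset.range J, |c i| := by
        refine (norm_sum_le _ _).trans ?_
        rw [Finset.mul_sum]
        refine Finset.sum_le_sum fun i _ => ?_
        rw [norm_smul, mul_comm, Real.norm_eq_abs]
        exact mul_le_mul_of_nonneg_right (ha i).le (abs_nonneg _)
      have h2 : (∑ i ∈ Finset.range J, |c i|) ^ 2 ≤ J * ∑ i ∈ Finset.range J, c i ^ 2 := by
        simpa using sq_sum_le_card_mul_sum_sq (s := Finset.range J) (f := fun i => |c i|)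
      have h3 : 0 ≤ ∑ i ∈ Finset.range J, c i ^ 2 := Finset.sum_nonneg fun i _ => sq_nonneg _
      calc _ ≤ (η * ∑ i ∈ Finset.range J, |c i|) ^ 2 := pow_le_pow_left₀ (norm_nonneg _) h1 2
        _ = η ^ 2 * (∑ i ∈ Finset.range J, |c i|) ^ 2 := mul_pow _ _ _
        _ ≤ η ^ 2 * (J * ∑ i ∈ Finset.range J, c i ^ 2) := by gcongr
        _ = (J * η ^ 2) * ∑ i ∈ Finset.range J, c i ^ 2 := by ring
        _ ≤ _ := by gcongr
    rw [e]
    set A := ∑ i ∈ Finset.range J, c i • trigL2 (i + 1)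
    set B := ∑ i ∈ Finset.range J, c i • (stepSignal (a i) - trigL2 (i + 1))
    have h1 : ‖A + B‖ ^ 2 ≤ (‖A‖ + ‖B‖) ^ 2 := pow_le_pow_left₀ (norm_nonneg _) (norm_add_le A B) 2
    nlinarith [sq_nonneg (‖A‖ - 8 * ‖B‖), sq_nonneg ‖A‖]
  · have h : ∀ i, fourierCoef g (i + 1) ^ 2 ≤
        2 * inner ℝ (stepSignal (a i)) g ^ 2 + 2 * (η ^ 2 * ‖g‖ ^ 2) := by
      intro i
      rw [← inner_trigL2_left]
      have h1 : |inner ℝ (stepSignal (a i)) g - inner ℝ (trigL2 (i + 1)) g| ≤ η * ‖g‖ := by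
        rw [← inner_sub_left]
        exact (abs_real_inner_le_norm _ _).trans
          (mul_le_mul_of_nonneg_right (ha i).le (norm_nonneg _))
      have h2 := sq_le_sq' (abs_le.1 h1).1 (abs_le.1 h1).2
      nlinarith [sq_nonneg (2 * inner ℝ (stepSignal (a i)) g - inner ℝ (trigL2 (i + 1)) g)]
    calc _ ≤ ∑ i ∈ Finset.range J, (2 * inner ℝ (stepSignal (a i)) g ^ 2 +
          2 * (η ^ 2 * ‖g‖ ^ 2)) := Finset.sum_le_sum fun i _ => h i
      _ = 2 * ∑ i ∈ Finset.range J, inner ℝ (stepSignal (a i)) g ^ 2 +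
          2 * (J * η ^ 2) * ‖g‖ ^ 2 := by
        rw [Finset.sum_add_distrib, Finset.mul_sum, Finset.sum_const, Finset.card_range,
          nsmul_eq_mul]
        ring
      _ ≤ _ := by nlinarith [sq_nonneg ‖g‖]

/-- A test of `f₀` against the signals at distance more than `R` from `f₀` that are well
approximated by their first `J` coefficients. -/
theorem exists_test {Ω : Type*} [MeasurableSpace Ω] {P : Measure Ω} [IsProbabilityMeasure P]
    {W : ℝ≥0 → Ω → ℝ} (hμ : IsIsonormal (pathLaw P W)) {n : ℕ} (hn : 0 < n) (f₀ : Signal) (J : ℕ)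
    (R : ℝ) :
    ∃ E : Set (unitInterval → ℝ), MeasurableSet E ∧
      whiteNoise P W n f₀ E ≤ ENNReal.ofReal (Real.exp (J - n * R ^ 2 / 64)) ∧
      ∀ f : Signal, R ^ 2 ≤ ‖f - f₀‖ ^ 2 →
        ‖f - f₀‖ ^ 2 - ∑ i ∈ Finset.range J, fourierCoef (f - f₀) (i + 1) ^ 2 ≤ R ^ 2 / 64 →
        whiteNoise P W n f Eᶜ ≤ ENNReal.ofReal (Real.exp (J - n * R ^ 2 / 64)) := by
  obtain ⟨a, ha, hag⟩ := exists_stepSignals_near_trig J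
  set T : (unitInterval → ℝ) → ℝ := fun y =>
    ∑ i ∈ Finset.range J, (pathIntegral y (a i) - inner ℝ (stepSignal (a i)) f₀) ^ 2 with hT
  have hTm : Measurable T :=
    Finset.measurable_sum _ fun i _ => ((measurable_pathIntegral (a i)).sub_const _).pow_const 2
  have hn' : (0 : ℝ) < n := by exact_mod_cast hn
  -- Either error of this test forces the pure noise energy `S` to be at least nR²/16, so one
  -- chi-square bound serves for both.
  set E := {y | R ^ 2 / 8 < T y} with hE
  have hEm : MeasurableSet E := measurableSet_lt measurable_const hTm
  set S : (unitInterval → ℝ) → ℝ := fun w => ∑ i ∈ Finset.range J, pathIntegral w (a i) ^ 2 with hS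
  have hS0 : ∀ w, 0 ≤ S w := fun w => Finset.sum_nonneg fun i _ => sq_nonneg _
  have hTe : ∀ f w, T (observedPath n f w) = ∑ i ∈ Finset.range J,
      (inner ℝ (stepSignal (a i)) (f - f₀) + (√(n : ℝ))⁻¹ * pathIntegral w (a i)) ^ 2 := by
    intro f w
    refine Finset.sum_congr rfl fun i _ => ?_
    rw [pathIntegral_observedPath, inner_sub_right, natCast_rpow_neg_half]
    ring
  have hc : ((√(n : ℝ))⁻¹) ^ 2 = (n : ℝ)⁻¹ := by
    rw [inv_pow, Real.sq_sqrt hn'.le]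
  have htail := measure_sum_sq_gt_le hμ J a ha (n * R ^ 2 / 16)
  have he : (J : ℝ) - n * R ^ 2 / 16 / 4 = J - n * R ^ 2 / 64 := by ring
  rw [he] at htail
  refine ⟨E, hEm, ?_, fun f hf1 hf2 => ?_⟩
  · rw [whiteNoise_apply P W n f₀ hEm]
    refine (measure_mono fun w hw => ?_).trans htail
    simp only [hE, Set.mem_ofPred_eq, hTe, sub_self, inner_zero_right, zero_add, mul_pow, hc,
      ← Finset.mul_sum] at hw ⊢
    rw [lt_inv_mul_iff₀ hn'] at hw
    nlinarith [sq_nonneg R]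
  · rw [whiteNoise_apply P W n f hEm.compl]
    refine (measure_mono fun w hw => ?_).trans htail
    simp only [hE, Set.mem_compl_iff, Set.mem_ofPred_eq, hTe, not_lt] at hw ⊢
    have h1 := hag (f - f₀)
    have h2 : ∑ i ∈ Finset.range J, inner ℝ (stepSignal (a i)) (f - f₀) ^ 2 ≤
        2 * ∑ i ∈ Finset.range J, (inner ℝ (stepSignal (a i)) (f - f₀) +
          (√(n : ℝ))⁻¹ * pathIntegral w (a i)) ^ 2 + 2 * ((n : ℝ)⁻¹ * S w) := by
      rw [hS, ← hc, Finset.mul_sum, Finset.mul_sum, Finset.mul_sum, ← Finset.sum_add_distrib]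
      refine Finset.sum_le_sum fun i _ => ?_
      nlinarith [sq_nonneg (inner ℝ (stepSignal (a i)) (f - f₀) +
        2 * ((√(n : ℝ))⁻¹ * pathIntegral w (a i)))]
    -- The signal contributes 2∑⟨a_i, f - f₀⟩² ≥ (31/32)R² - R²/64 = (61/64)R². Acceptance bounds
    -- the observed part by R²/8, which leaves S/n ≥ (29/256)R².
    have h3 : R ^ 2 / 16 ≤ (n : ℝ)⁻¹ * S w := by nlinarith
    rw [inv_mul_eq_div, le_div_iff₀ hn'] at h3
    change (n : ℝ) * R ^ 2 / 16 ≤ S w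
    linarith

/-! ### From a test and prior mass to the expected posterior mass. -/

/-- Let D be the event that the test accepts and yet the posterior mass of `A` exceeds `s`. Markov's
inequality under the marginal law of the data bounds the marginal probability of D by the type II
error averaged over `A`. The two-point hypothesis, averaged over `U`, turns this into a bound on D
under θ₀. The posterior mass is then at most 1_E + s + 1_D. -/
theorem lintegral_posterior_le {𝓧 Θ : Type*} [MeasurableSpace 𝓧] [MeasurableSpace Θ]
    [StandardBorelSpace Θ] [Nonempty Θ] (κ : Kernel Θ 𝓧) [IsFiniteKernel κ]
    (μ : Measure Θ) [IsFiniteMeasure μ] (θ₀ : Θ) (hθ₀ : κ θ₀ Set.univ ≤ 1)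
    {A U : Set Θ} (hA : MeasurableSet A) (hU0 : μ U ≠ 0)
    {E : Set 𝓧} (hE : MeasurableSet E) {K s δ : ℝ≥0∞} (hs : s ≠ 0) (hs' : s ≠ ∞)
    (hK : ∀ θ ∈ U, ∀ D, MeasurableSet D → κ θ₀ D ^ 2 ≤ K * κ θ D)
    (h : K * ∫⁻ θ in A, κ θ Eᶜ ∂μ ≤ s * μ U * δ ^ 2) :
    ∫⁻ y, posterior κ μ y A ∂(κ θ₀) ≤ κ θ₀ E + s + δ := by
  set q : 𝓧 → ℝ≥0∞ := fun y => posterior κ μ y A with hq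
  have hqm : Measurable q := Kernel.measurable_coe _ hA
  have hq1 : ∀ y, q y ≤ 1 := fun y => prob_le_one
  set D : Set 𝓧 := {y | s < q y} \ E with hD
  have hDm : MeasurableSet D := (measurableSet_lt measurable_const hqm).diff hE
  have h1 : s * (κ ∘ₘ μ) D ≤ ∫⁻ θ in A, κ θ Eᶜ ∂μ := by
    calc s * (κ ∘ₘ μ) D = ∫⁻ _ in D, s ∂(κ ∘ₘ μ) := by rw [setLIntegral_const]
      _ ≤ ∫⁻ y in D, q y ∂(κ ∘ₘ μ) := setLIntegral_mono hqm fun y hy => hy.1.le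
      _ = ((κ ∘ₘ μ) ⊗ₘ posterior κ μ) (D ×ˢ A) := by
          rw [Measure.compProd_apply_prod hDm hA]
      _ = (μ ⊗ₘ κ) (A ×ˢ D) := by
          -- The posterior enters only through the two disintegrations of the joint law of parameter
          -- and data.
          rw [compProd_posterior_eq_map_swap, Measure.map_apply measurable_swap (hDm.prod hA),
            Set.preimage_swap_prod]
      _ = ∫⁻ θ in A, κ θ D ∂μ := Measure.compProd_apply_prod hA hDm
      _ ≤ _ := lintegral_mono fun θ => measure_mono fun y hy => hy.2
  have h2 : μ U * κ θ₀ D ^ 2 ≤ K * (κ ∘ₘ μ) D := by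
    calc μ U * κ θ₀ D ^ 2 = ∫⁻ _ in U, κ θ₀ D ^ 2 ∂μ := by rw [setLIntegral_const, mul_comm]
      _ ≤ ∫⁻ θ in U, K * κ θ D ∂μ :=
          setLIntegral_mono ((Kernel.measurable_coe κ hDm).const_mul K) fun θ hθ => hK θ hθ D hDm
      _ ≤ ∫⁻ θ, K * κ θ D ∂μ := setLIntegral_le_lintegral _ _
      _ = K * (κ ∘ₘ μ) D := by
          rw [lintegral_const_mul _ (Kernel.measurable_coe κ hDm),
            Measure.bind_apply hDm κ.aemeasurable]
  have h3 : κ θ₀ D ≤ δ := by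
    have h4 : s * μ U * κ θ₀ D ^ 2 ≤ s * μ U * δ ^ 2 := by
      calc s * μ U * κ θ₀ D ^ 2 = s * (μ U * κ θ₀ D ^ 2) := mul_assoc _ _ _
        _ ≤ s * (K * (κ ∘ₘ μ) D) := by gcongr
        _ = K * (s * (κ ∘ₘ μ) D) := by ring
        _ ≤ K * ∫⁻ θ in A, κ θ Eᶜ ∂μ := by gcongr
        _ ≤ _ := h
    rw [ENNReal.mul_le_mul_iff_right (mul_ne_zero hs hU0)
      (ENNReal.mul_ne_top hs' (measure_ne_top _ _))] at h4
    exact (ENNReal.pow_le_pow_left_iff two_ne_zero).1 h4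
  calc ∫⁻ y, q y ∂(κ θ₀) ≤ ∫⁻ y, (E.indicator 1 y + s + D.indicator 1 y) ∂(κ θ₀) := by
        refine lintegral_mono fun y => ?_
        by_cases hyE : y ∈ E
        · simp only [hyE, Set.indicator_of_mem, Pi.one_apply]
          exact (hq1 y).trans (by rw [add_assoc]; exact le_self_add)
        · by_cases hys : s < q y
          · have : y ∈ D := ⟨hys, hyE⟩
            simp only [this, Set.indicator_of_mem, Pi.one_apply]
            exact (hq1 y).trans le_add_self
          · exact (not_lt.1 hys).trans (le_add_self.trans le_self_add)
    _ = κ θ₀ E + s * κ θ₀ Set.univ + κ θ₀ D := by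
        rw [lintegral_add_right _ (measurable_one.indicator hDm),
          lintegral_add_right _ measurable_const, lintegral_indicator_one hE,
          lintegral_indicator_one hDm, lintegral_const]
    _ ≤ κ θ₀ E + s * 1 + δ := by gcongr
    _ = _ := by rw [mul_one]

/-! ### The blocks -/

theorem blockStart_mono : Monotone blockStart := fun k l h =>
  Nat.floor_mono (Real.exp_le_exp.2 (by exact_mod_cast h))

theorem one_le_blockStart (k : ℕ) : 1 ≤ blockStart k :=
  Nat.le_floor (by simp)

theorem blockStart_le_exp (k : ℕ) : (blockStart k : ℝ) ≤ Real.exp k :=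
  Nat.floor_le (Real.exp_pos _).le

theorem exp_le_two_mul_blockStart (k : ℕ) : Real.exp k ≤ 2 * blockStart k := by
  have h1 : Real.exp k < blockStart k + 1 := Nat.lt_floor_add_one _
  have h2 : (1 : ℝ) ≤ blockStart k := by exact_mod_cast one_le_blockStart k
  linarith

theorem le_blockIndex {K j : ℕ} (h : blockStart K ≤ j) : K ≤ blockIndex j := by
  by_contra! hlt
  have := (blockIndex_spec ((one_le_blockStart K).trans h)).2
  have := blockStart_mono (show blockIndex j + 1 ≤ K from hlt)
  omega

theorem blockIndex_lt {K j : ℕ} (hj : 1 ≤ j) (h : j < blockStart K) : blockIndex j < K := by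
  by_contra! hle
  have := (blockIndex_spec hj).1
  have := blockStart_mono hle
  omega

theorem exp_blockIndex_le {j : ℕ} (hj : 1 ≤ j) : Real.exp (blockIndex j) ≤ 2 * j := by
  have h : ((blockStart (blockIndex j) : ℕ) : ℝ) ≤ j := by exact_mod_cast (blockIndex_spec hj).1
  linarith [exp_le_two_mul_blockStart (blockIndex j)]

theorem le_exp_blockIndex_add_one {j : ℕ} (hj : 1 ≤ j) :
    (j : ℝ) ≤ Real.exp (blockIndex j + 1) := by
  have h : (j : ℝ) ≤ blockStart (blockIndex j + 1) := by
    exact_mod_cast (blockIndex_spec hj).2.le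
  refine h.trans ((blockStart_le_exp _).trans_eq ?_)
  push_cast
  rfl

/-! ### Product measures and the Gaussian law -/

/-- The first `N` coordinates are treated exactly by independence, the rest by a union bound on the
complements. -/
theorem prod_mul_one_sub_tsum_le_infinitePi {X : ℕ → Type*} [∀ i, MeasurableSpace (X i)]
    (μ : ∀ i, Measure (X i)) [∀ i, IsProbabilityMeasure (μ i)] {S : ∀ i, Set (X i)}
    (hS : ∀ i, MeasurableSet (S i)) (N : ℕ) :
    (∏ i ∈ Finset.range N, μ i (S i)) * (1 - ∑' i, μ (i + N) (S (i + N))ᶜ) ≤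
      Measure.infinitePi μ (Set.univ.pi S) := by
  rw [Measure.infinitePi_pi_univ μ hS, ENNReal.tprod_eq_iInf_prod fun i => prob_le_one]
  refine le_iInf fun s => ?_
  have h1 : ∏ i ∈ s ∪ Finset.range N, μ i (S i) ≤ ∏ i ∈ s, μ i (S i) :=
    Finset.prod_le_prod_of_subset_of_le_one' Finset.subset_union_left fun i _ _ => prob_le_one
  refine le_trans ?_ h1
  rw [← Finset.sdiff_union_self_eq_union, Finset.prod_union Finset.sdiff_disjoint, mul_comm]
  gcongr
  set t := s \ Finset.range N with ht
  have htN : ∀ i ∈ t, N ≤ i := fun i hi => by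
    simp only [ht, Finset.mem_sdiff, Finset.mem_range, not_lt] at hi
    exact hi.2
  rw [← Measure.infinitePi_pi μ fun i _ => hS i]
  have hm : MeasurableSet (Set.pi (t : Set ℕ) S) :=
    MeasurableSet.pi t.countable_toSet fun i _ => hS i
  have h2 := prob_compl_eq_one_sub (μ := Measure.infinitePi μ) hm.compl
  rw [compl_compl] at h2
  rw [h2]
  refine tsub_le_tsub_left ?_ 1
  have h3 : (Set.pi (t : Set ℕ) S)ᶜ ⊆ ⋃ i ∈ t, (fun x : ∀ i, X i => x i) ⁻¹' (S i)ᶜ := by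
    intro x hx
    simp only [Set.mem_compl_iff, Set.mem_pi, not_forall] at hx
    obtain ⟨i, hi, hxi⟩ := hx
    exact Set.mem_biUnion hi hxi
  calc Measure.infinitePi μ (Set.pi (t : Set ℕ) S)ᶜ
      ≤ ∑ i ∈ t, Measure.infinitePi μ ((fun x : ∀ i, X i => x i) ⁻¹' (S i)ᶜ) :=
        (measure_mono h3).trans (measure_biUnion_finset_le _ _)
    _ = ∑ i ∈ t, μ i (S i)ᶜ := by
        refine Finset.sum_congr rfl fun i _ => ?_
        rw [← Measure.map_apply (measurable_pi_apply i) (hS i).compl, Measure.infinitePi_map_eval]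
    _ = ∑ i ∈ t.image (fun i => i - N), μ (i + N) (S (i + N))ᶜ := by
        rw [Finset.sum_image]
        · refine Finset.sum_congr rfl fun i hi => ?_
          rw [Nat.sub_add_cancel (htN i hi)]
        · intro i hi j hj hij
          have := htN i hi
          have := htN j hj
          simp only at hij
          omega
    _ ≤ _ := ENNReal.sum_le_tsum _

theorem gaussianReal_compl_Icc_le (x : ℝ) (hx : 0 ≤ x) :
    gaussianReal 0 1 (Set.Icc (-x) x)ᶜ ≤ ENNReal.ofReal (2 * Real.exp (-(3 / 8 * x ^ 2))) := by
  have hm : Measurable fun z : ℝ => ENNReal.ofReal (Real.exp (3 / 8 * z ^ 2)) := by fun_prop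
  have h := mul_meas_ge_le_lintegral (μ := gaussianReal 0 1) hm
    (ENNReal.ofReal (Real.exp (3 / 8 * x ^ 2)))
  rw [lintegral_exp_sq_gaussianReal] at h
  have h1 : gaussianReal 0 1 (Set.Icc (-x) x)ᶜ ≤ gaussianReal 0 1
      {z | ENNReal.ofReal (Real.exp (3 / 8 * x ^ 2)) ≤ ENNReal.ofReal (Real.exp (3 / 8 * z ^ 2))} := by
    refine measure_mono fun z hz => ENNReal.ofReal_le_ofReal (Real.exp_le_exp.2 ?_)
    have : x < |z| := by
      by_contra! hle
      exact hz (Set.mem_Icc.2 (abs_le.1 hle))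
    have : x ^ 2 ≤ z ^ 2 := by
      rw [← sq_abs z]
      exact pow_le_pow_left₀ hx this.le 2
    linarith
  calc _ ≤ _ := h1
    _ = ENNReal.ofReal (Real.exp (-(3 / 8 * x ^ 2))) *
        (ENNReal.ofReal (Real.exp (3 / 8 * x ^ 2)) * gaussianReal 0 1
      {z | ENNReal.ofReal (Real.exp (3 / 8 * x ^ 2)) ≤
        ENNReal.ofReal (Real.exp (3 / 8 * z ^ 2))}) := by
        rw [← mul_assoc, ← ENNReal.ofReal_mul (Real.exp_pos _).le, ← Real.exp_add]
        simp
    _ ≤ ENNReal.ofReal (Real.exp (-(3 / 8 * x ^ 2))) * 2 := by gcongr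
    _ = _ := by
        rw [ENNReal.ofReal_mul (by norm_num), mul_comm]
        simp

/-- The set is an interval of length 2δ/√a on which z² ≤ 2(θ² + δ²)/a. The length gives the
logarithm, the density gives the quotient, and e^{-1} ≤ 2/√(2π) accounts for the 1. -/
theorem le_gaussianReal_near {a δ : ℝ} (ha : 0 < a) (hδ : 0 < δ) (θ : ℝ) :
    ENNReal.ofReal (Real.exp (-((θ ^ 2 + δ ^ 2) / a + 1 + Real.log (a / δ ^ 2) / 2))) ≤
      gaussianReal 0 1 {z | |√a * z - θ| ≤ δ} := by
  have hsa : 0 < √a := Real.sqrt_pos.2 ha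
  have hset : {z : ℝ | |√a * z - θ| ≤ δ} = Set.Icc ((θ - δ) / √a) ((θ + δ) / √a) := by
    ext z
    simp only [Set.mem_ofPred_eq, Set.mem_Icc, abs_le, div_le_iff₀ hsa, le_div_iff₀ hsa]
    constructor <;> rintro ⟨h1, h2⟩ <;> constructor <;> linarith
  rw [gaussianReal_apply 0 one_ne_zero]
  have hlow : ∀ z ∈ {z : ℝ | |√a * z - θ| ≤ δ},
      ENNReal.ofReal ((√(2 * Real.pi))⁻¹ * Real.exp (-((θ ^ 2 + δ ^ 2) / a))) ≤
        gaussianPDF 0 1 z := by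
    intro z hz
    refine ENNReal.ofReal_le_ofReal ?_
    rw [gaussianPDFReal]
    simp only [NNReal.coe_one, mul_one, sub_zero]
    gcongr
    rw [neg_div, neg_le_neg_iff, div_le_div_iff₀ (by norm_num) ha]
    have h1 := abs_le.1 (show |√a * z - θ| ≤ δ from hz)
    have h2 : (√a * z) ^ 2 ≤ 2 * (θ ^ 2 + δ ^ 2) := by
      nlinarith [sq_nonneg (√a * z - 2 * θ), sq_le_sq' h1.1 h1.2]
    rw [mul_pow, Real.sq_sqrt ha.le] at h2
    linarith
  calc ENNReal.ofReal (Real.exp (-((θ ^ 2 + δ ^ 2) / a + 1 + Real.log (a / δ ^ 2) / 2)))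
      ≤ ENNReal.ofReal ((√(2 * Real.pi))⁻¹ * Real.exp (-((θ ^ 2 + δ ^ 2) / a)) *
          (2 * δ / √a)) := by
        refine ENNReal.ofReal_le_ofReal ?_
        have e1 : Real.exp (-(Real.log (a / δ ^ 2) / 2)) = δ / √a := by
          rw [← neg_div, ← Real.log_inv, inv_div, ← Real.log_sqrt (by positivity),
            Real.exp_log (Real.sqrt_pos.2 (by positivity)), Real.sqrt_div (by positivity),
            Real.sqrt_sq hδ.le]
        rw [show -((θ ^ 2 + δ ^ 2) / a + 1 + Real.log (a / δ ^ 2) / 2) =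
          -((θ ^ 2 + δ ^ 2) / a) + (-1 + -(Real.log (a / δ ^ 2) / 2)) by ring, Real.exp_add,
          Real.exp_add, e1]
        have e2 : Real.exp (-1) ≤ (√(2 * Real.pi))⁻¹ * 2 := by
          have h3 : √(2 * Real.pi) ≤ 4 := by
            rw [Real.sqrt_le_left (by norm_num)]
            nlinarith [Real.pi_lt_four]
          have h4 : Real.exp (-1) ≤ 1 / 2 := by
            rw [Real.exp_neg, ← one_div]
            exact one_div_le_one_div_of_le (by norm_num) (by linarith [Real.add_one_le_exp (1 : ℝ)])
          have h5 : (4 : ℝ)⁻¹ ≤ (√(2 * Real.pi))⁻¹ := inv_anti₀ (by positivity) h3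
          linarith
        calc _ ≤ Real.exp (-((θ ^ 2 + δ ^ 2) / a)) * (((√(2 * Real.pi))⁻¹ * 2) * (δ / √a)) := by
              gcongr
          _ = _ := by ring
    _ = ENNReal.ofReal ((√(2 * Real.pi))⁻¹ * Real.exp (-((θ ^ 2 + δ ^ 2) / a))) *
          volume {z : ℝ | |√a * z - θ| ≤ δ} := by
        rw [hset, Real.volume_Icc, ← ENNReal.ofReal_mul (by positivity)]
        congr 2
        ring
    _ = ∫⁻ _ in {z : ℝ | |√a * z - θ| ≤ δ},
          ENNReal.ofReal ((√(2 * Real.pi))⁻¹ * Real.exp (-((θ ^ 2 + δ ^ 2) / a))) := by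
        rw [setLIntegral_const]
    _ ≤ _ := setLIntegral_mono (measurable_gaussianPDF 0 1) hlow

/-! ### The scales -/

theorem scaleLaw_Ioi_le {G : MixingDensities} {c : ℝ}
    (h : ∀ k : ℕ, ∫⁻ t in Set.Ioi (Real.exp (-(k : ℝ) ^ 2)), ENNReal.ofReal (G.g k t)
      ≤ ENNReal.ofReal (Real.exp (-(c * Real.exp k)))) (k : ℕ) :
    scaleLaw G k (Set.Iic (Real.exp (-(k : ℝ) ^ 2)))ᶜ ≤
      ENNReal.ofReal (Real.exp (-(c * Real.exp k))) := by
  rw [Set.compl_Iic, scaleLaw, withDensity_apply _ measurableSet_Ioi,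
    Measure.restrict_restrict measurableSet_Ioi, Set.Ioi_inter_Ioi,
    sup_eq_left.2 (Real.exp_pos _).le]
  exact h k

/-- The windows exhaust (0, ∞), so some window has positive mass, while the left side tends to 0. -/
theorem eventually_scaleLaw_Icc_pos (G : MixingDensities) (b : ℝ) (k : ℕ) :
    ∀ᶠ m : ℝ in atTop, ENNReal.ofReal (Real.exp (-(m * Real.exp k))) ≤
      scaleLaw G k (Set.Icc (Real.exp (-(b * k)) / m) (m * Real.exp (-(b * k)))) := by
  set S : ℕ → Set ℝ := fun m => Set.Icc (Real.exp (-(b * k)) / (m + 1)) ((m + 1) *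
    Real.exp (-(b * k))) with hS
  have hU : Set.Ioi (0 : ℝ) ⊆ ⋃ m, S m := by
    intro x hx
    have hx : 0 < x := hx
    obtain ⟨m1, h1⟩ := exists_nat_ge (Real.exp (-(b * k)) / x)
    obtain ⟨m2, h2⟩ := exists_nat_ge (x / Real.exp (-(b * k)))
    rw [div_le_iff₀ hx] at h1
    rw [div_le_iff₀ (Real.exp_pos _)] at h2
    refine Set.mem_iUnion.2 ⟨m1 + m2, ?_, ?_⟩
    · rw [div_le_iff₀ (by positivity)]
      push_cast
      nlinarith [(Nat.cast_nonneg m2 : (0 : ℝ) ≤ m2)]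
    · push_cast
      nlinarith [(Nat.cast_nonneg m1 : (0 : ℝ) ≤ m1), Real.exp_pos (-(b * k))]
  obtain ⟨m0, hm0⟩ : ∃ m, scaleLaw G k (S m) ≠ 0 := by
    by_contra! h
    have h1 : scaleLaw G k (⋃ m, S m) = 0 := measure_iUnion_null h
    have h2 : scaleLaw G k (Set.Ioi 0) = 0 := measure_mono_null hU h1
    rw [scaleLaw, withDensity_apply _ measurableSet_Ioi,
      Measure.restrict_restrict measurableSet_Ioi, Set.inter_self, G.lintegral_eq_one k] at h2
    exact one_ne_zero h2
  have hlim : Tendsto (fun m : ℝ => ENNReal.ofReal (Real.exp (-(m * Real.exp k)))) atTop (𝓝 0) := by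
    rw [← ENNReal.ofReal_zero]
    refine (ENNReal.continuous_ofReal.tendsto 0).comp (Real.tendsto_exp_neg_atTop_nhds_zero.comp ?_)
    exact tendsto_id.atTop_mul_const (Real.exp_pos _)
  filter_upwards [hlim.eventually_le_const (pos_iff_ne_zero.2 hm0), eventually_ge_atTop ((m0 : ℝ) + 1)]
    with m h1 h2
  refine h1.trans (measure_mono (Set.Icc_subset_Icc ?_ ?_))
  · gcongr
  · gcongr

/-- For large k the lower bound on the densities covers scales of order e^{-bk}. For the finitely
many other k these scales may lie outside [e^{-k²}, e^{-k}], and a wide window is used instead. -/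
theorem exists_scaleLaw_Icc_ge {G : MixingDensities} (hG : G.InClass) {b : ℝ} (hb : 1 ≤ b) :
    ∃ m : ℝ, 1 ≤ m ∧ ∀ k : ℕ, ENNReal.ofReal (Real.exp (-(m * Real.exp k))) ≤
      scaleLaw G k (Set.Icc (Real.exp (-(b * k)) / m) (m * Real.exp (-(b * k)))) := by
  obtain ⟨c, hc, hlow⟩ := hG.lower
  -- For k ≥ b + 1 one has k² ≥ bk + 1, so [e^{-bk-1}, e^{-bk}] lies in [e^{-k²}, e^{-k}].
  obtain ⟨k₀, hk₀⟩ := exists_nat_ge (b + 1)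
  have hsmall : ∀ᶠ m : ℝ in atTop, ∀ k ∈ Finset.range k₀,
      ENNReal.ofReal (Real.exp (-(m * Real.exp k))) ≤
      scaleLaw G k (Set.Icc (Real.exp (-(b * k)) / m) (m * Real.exp (-(b * k)))) :=
    (Finset.eventually_all _).2 fun k _ => eventually_scaleLaw_Icc_pos G b k
  -- Here m ≥ e lets the window contain [e^{-bk-1}, e^{-bk}], and m ≥ b + 1 + c pays for the density
  -- bound together with the length of that interval.
  obtain ⟨m, hm1, hm2, hm3⟩ := (hsmall.and ((eventually_ge_atTop (Real.exp 1)).and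
    (eventually_ge_atTop (b + 1 + c)))).exists
  have hm1' : (1 : ℝ) ≤ m := le_trans (by linarith [Real.add_one_le_exp (1 : ℝ)]) hm2
  refine ⟨m, hm1', fun k => ?_⟩
  rcases lt_or_ge k k₀ with hk | hk
  · exact hm1 k (Finset.mem_range.2 hk)
  have hkb : b + 1 ≤ k := hk₀.trans (by exact_mod_cast hk)
  have hk1 : (1 : ℝ) ≤ k := by linarith
  set u := Real.exp (-(b * k) - 1) with hu
  set v := Real.exp (-(b * k)) with hv
  have huv : v = Real.exp 1 * u := by
    rw [hu, hv, ← Real.exp_add]; ring_nf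
  have hu0 : 0 < u := Real.exp_pos _
  have hsub : Set.Icc u v ⊆ Set.Icc (v / m) (m * v) := by
    refine Set.Icc_subset_Icc ?_ ?_
    · rw [div_le_iff₀ (by linarith), huv]
      nlinarith
    · nlinarith [Real.exp_pos (-(b * k))]
  have hpos : Set.Icc u v ⊆ Set.Ioi 0 := fun x hx => lt_of_lt_of_le hu0 hx.1
  refine le_trans ?_ (measure_mono hsub)
  rw [scaleLaw, withDensity_apply _ measurableSet_Icc, Measure.restrict_restrict measurableSet_Icc,
    Set.inter_eq_left.2 hpos]
  have hg : ∀ t ∈ Set.Icc u v, ENNReal.ofReal (Real.exp (-(c * Real.exp k))) ≤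
      ENNReal.ofReal (G.g k t) := by
    intro t ht
    refine ENNReal.ofReal_le_ofReal (hlow k t ⟨?_, ?_⟩)
    · refine le_trans (Real.exp_le_exp.2 ?_) ht.1
      nlinarith
    · refine ht.2.trans (Real.exp_le_exp.2 ?_)
      nlinarith
  calc ENNReal.ofReal (Real.exp (-(m * Real.exp k)))
      ≤ ENNReal.ofReal (Real.exp (-(c * Real.exp k)) * (v - u)) := by
        refine ENNReal.ofReal_le_ofReal ?_
        have h1 : u ≤ v - u := by
          rw [huv]
          nlinarith [Real.add_one_le_exp (1 : ℝ)]
        have hke : (k : ℝ) + 1 ≤ Real.exp k := Real.add_one_le_exp _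
        calc Real.exp (-(m * Real.exp k)) ≤ Real.exp (-(c * Real.exp k)) * u := by
              rw [hu, ← Real.exp_add]
              refine Real.exp_le_exp.2 ?_
              nlinarith [Real.exp_pos (k : ℝ)]
          _ ≤ _ := by gcongr
    _ = ∫⁻ _ in Set.Icc u v, ENNReal.ofReal (Real.exp (-(c * Real.exp k))) := by
        rw [setLIntegral_const, Real.volume_Icc, ENNReal.ofReal_mul (Real.exp_pos _).le]
    _ ≤ _ := setLIntegral_mono (G.measurable k).ennreal_ofReal hg

/-! ### Tails of Fourier series -/

theorem fourierCoef_sub (f g : Signal) (j : ℕ) :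
    fourierCoef (f - g) j = fourierCoef f j - fourierCoef g j := by
  simp only [← inner_trigL2_left, inner_sub_right]

/-- The energy `∑_{i ≥ N} θ_{i+1}²` of the coefficients after the first `N`. -/
def tailEnergy (N : ℕ) (f : Signal) : ℝ := ∑' i, fourierCoef f (i + N + 1) ^ 2

theorem summable_tailEnergy (N : ℕ) (f : Signal) :
    Summable fun i => fourierCoef f (i + N + 1) ^ 2 :=
  (summable_nat_add_iff N).2 (hasSum_fourierCoef_sq f).summable

theorem tailEnergy_eq (N : ℕ) (f : Signal) :
    tailEnergy N f = ‖f‖ ^ 2 - ∑ i ∈ Finset.range N, fourierCoef f (i + 1) ^ 2 := by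
  have h := (hasSum_fourierCoef_sq f).summable.sum_add_tsum_nat_add N
  rw [(hasSum_fourierCoef_sq f).tsum_eq] at h
  rw [tailEnergy]
  linarith

theorem tailEnergy_sub_le (N : ℕ) (f g : Signal) :
    tailEnergy N (f - g) ≤ 2 * tailEnergy N f + 2 * tailEnergy N g := by
  unfold tailEnergy
  rw [← tsum_mul_left, ← tsum_mul_left, ← Summable.tsum_add
    ((summable_tailEnergy N f).mul_left 2) ((summable_tailEnergy N g).mul_left 2)]
  refine Summable.tsum_le_tsum (fun i => ?_) (summable_tailEnergy N _)
    (((summable_tailEnergy N f).mul_left 2).add ((summable_tailEnergy N g).mul_left 2))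
  rw [fourierCoef_sub]
  nlinarith [sq_nonneg (fourierCoef f (i + N + 1) + fourierCoef g (i + N + 1))]

theorem continuous_tailEnergy (N : ℕ) : Continuous (tailEnergy N) := by
  have : tailEnergy N = fun f =>
      ‖f‖ ^ 2 - ∑ i ∈ Finset.range N, inner ℝ (trigL2 (i + 1)) f ^ 2 := by
    ext f
    simp only [tailEnergy_eq, inner_trigL2_left]
  rw [this]
  fun_prop

theorem sum_rpow_mul_sq_le_of_mem_sobolevBall {α Q : ℝ} {f : Signal} (hf : f ∈ sobolevBall α Q)
    (s : Finset ℕ) :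
    ∑ i ∈ s, ((i + 1 : ℕ) : ℝ) ^ (2 * α) * fourierCoef f (i + 1) ^ 2 ≤ Q ^ 2 := by
  have h : ∑ i ∈ s, ENNReal.ofReal (((i + 1 : ℕ) : ℝ) ^ (2 * α) * fourierCoef f (i + 1) ^ 2) ≤
      ENNReal.ofReal (Q ^ 2) := (ENNReal.sum_le_tsum s).trans hf
  rw [← ENNReal.ofReal_sum_of_nonneg fun i _ => by positivity,
    ENNReal.ofReal_le_ofReal_iff (sq_nonneg Q)] at h
  exact h

theorem blockStart_rpow_neg_le {α : ℝ} (hα : 0 < α) (K : ℕ) :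
    (blockStart K : ℝ) ^ (-(2 * α)) ≤ 2 ^ (2 * α) * Real.exp (-(2 * α * K)) := by
  have h1 : Real.exp K / 2 ≤ blockStart K := by linarith [exp_le_two_mul_blockStart K]
  calc (blockStart K : ℝ) ^ (-(2 * α)) ≤ (Real.exp K / 2) ^ (-(2 * α)) :=
        Real.rpow_le_rpow_of_nonpos (by positivity) h1 (by linarith)
    _ = 2 ^ (2 * α) * Real.exp (-(2 * α * K)) := by
        rw [Real.div_rpow (Real.exp_pos _).le (by norm_num), ← Real.exp_mul, Real.rpow_neg (by norm_num),
          div_inv_eq_mul, mul_comm]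
        ring_nf

theorem le_sub_one_add_one_add (K i : ℕ) : blockStart K ≤ i + (blockStart K - 1) + 1 := by
  have := one_le_blockStart K
  omega

theorem tailEnergy_le_of_mem_sobolevBall {α Q : ℝ} (hα : 0 < α) {f : Signal}
    (hf : f ∈ sobolevBall α Q) (K : ℕ) :
    tailEnergy (blockStart K - 1) f ≤ 2 ^ (2 * α) * Q ^ 2 * Real.exp (-(2 * α * K)) := by
  -- Position `i` carries the coefficient of φ_{i+1}, so exactly `blockStart K - 1` positions
  -- precede the block `B_K`.
  set N := blockStart K - 1
  have hl : (0 : ℝ) < blockStart K := by exact_mod_cast one_le_blockStart K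
  have h1 : tailEnergy N f ≤ (blockStart K : ℝ) ^ (-(2 * α)) * Q ^ 2 := by
    refine Real.tsum_le_of_sum_range_le (fun i => sq_nonneg _) fun n => ?_
    have h2 := sum_rpow_mul_sq_le_of_mem_sobolevBall hf ((Finset.range n).map (addRightEmbedding N))
    rw [Finset.sum_map] at h2
    simp only [addRightEmbedding_apply] at h2
    refine le_trans ?_ (mul_le_mul_of_nonneg_left h2 (by positivity))
    rw [Finset.mul_sum]
    refine Finset.sum_le_sum fun i _ => ?_
    have h3 : (blockStart K : ℝ) ≤ ((i + N + 1 : ℕ) : ℝ) := by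
      exact_mod_cast le_sub_one_add_one_add K i
    have h4 : (blockStart K : ℝ) ^ (2 * α) ≤ ((i + N + 1 : ℕ) : ℝ) ^ (2 * α) :=
      Real.rpow_le_rpow hl.le h3 (by linarith)
    have h5 : 1 ≤ (blockStart K : ℝ) ^ (-(2 * α)) * ((i + N + 1 : ℕ) : ℝ) ^ (2 * α) := by
      rw [Real.rpow_neg hl.le, inv_mul_eq_div, one_le_div (by positivity)]
      exact h4
    rw [← mul_assoc]
    exact le_mul_of_one_le_left (sq_nonneg _) h5
  refine h1.trans ?_
  have := blockStart_rpow_neg_le hα K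
  calc _ ≤ 2 ^ (2 * α) * Real.exp (-(2 * α * K)) * Q ^ 2 := by gcongr
    _ = _ := by ring

/-! ### Tails of the prior -/

/-- A bound for the coefficients on the blocks where the scales are small. -/
def envelope (i : ℕ) : ℝ := 2 * ((i : ℝ) + 1) * Real.exp (-((blockIndex (i + 1) : ℝ) ^ 2 / 2))

/-- The sequences that are bounded by the envelope from the block `B_K` on. -/
def tailSet (K : ℕ) : Set (ℕ → ℝ) := {θ | ∀ i, blockStart K ≤ i + 1 → |θ i| ≤ envelope i}

theorem measurableSet_tailSet (K : ℕ) : MeasurableSet (tailSet K) := by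
  have : tailSet K = ⋂ i, ⋂ (_ : blockStart K ≤ i + 1), {θ : ℕ → ℝ | |θ i| ≤ envelope i} := by
    ext θ; simp [tailSet]
  rw [this]
  refine MeasurableSet.iInter fun i => MeasurableSet.iInter fun _ => ?_
  exact measurableSet_le (measurable_pi_apply i).abs measurable_const

/-- Since k ≥ log j - 1 on the block of j, the factor e^{-k²} is smaller than any power of j. Hence
one envelope serves every smoothness α. -/
theorem exists_envelope_sq_le {α : ℝ} (hα : 0 < α) :
    ∃ C : ℝ, 0 < C ∧ ∀ i : ℕ, envelope i ^ 2 ≤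
      C * (((i + 1 : ℕ) : ℝ) ^ (-(2 * α)) * (1 / ((i : ℝ) + 1) ^ 2)) := by
  -- Of the four extra powers, two cancel the factor (i + 1)² of the squared envelope and two make
  -- the bound summable.
  set p : ℝ := 2 * α + 4 with hp
  refine ⟨4 * Real.exp (p ^ 2 / 4 + p), by positivity, fun i => ?_⟩
  set k := blockIndex (i + 1) with hk
  have hj : (0 : ℝ) < ((i + 1 : ℕ) : ℝ) := by positivity
  have h1 : Real.exp (-(k : ℝ) ^ 2) ≤
      Real.exp (p ^ 2 / 4 + p) * ((i + 1 : ℕ) : ℝ) ^ (-p) := by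
    calc Real.exp (-(k : ℝ) ^ 2) ≤ Real.exp (p ^ 2 / 4 + p) * Real.exp ((k + 1) * (-p)) := by
          rw [← Real.exp_add]
          refine Real.exp_le_exp.2 ?_
          nlinarith [sq_nonneg ((k : ℝ) - p / 2)]
      _ = Real.exp (p ^ 2 / 4 + p) * Real.exp (k + 1) ^ (-p) := by rw [Real.exp_mul]
      _ ≤ _ := by
          gcongr ?_ * ?_
          exact Real.rpow_le_rpow_of_nonpos hj (le_exp_blockIndex_add_one (by omega))
            (by rw [hp]; linarith)
  have h2 : ((i + 1 : ℕ) : ℝ) ^ (-p) =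
      ((i + 1 : ℕ) : ℝ) ^ (-(2 * α)) * (1 / ((i : ℝ) + 1) ^ 2) * (1 / ((i : ℝ) + 1) ^ 2) := by
    rw [hp, show -(2 * α + 4) = -(2 * α) - (4 : ℕ) by push_cast; ring, Real.rpow_sub_natCast hj.ne']
    push_cast
    field_simp
  calc envelope i ^ 2 = 4 * ((i : ℝ) + 1) ^ 2 * Real.exp (-(k : ℝ) ^ 2) := by
        rw [envelope, mul_pow, mul_pow, ← Real.exp_nat_mul]
        congr 1
        · ring
        · congr 1
          push_cast
          ring
    _ ≤ 4 * ((i : ℝ) + 1) ^ 2 * (Real.exp (p ^ 2 / 4 + p) * ((i + 1 : ℕ) : ℝ) ^ (-p)) := by gcongr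
    _ = _ := by
        rw [h2]
        have : ((i : ℝ) + 1) ≠ 0 := by positivity
        field_simp

theorem exists_tsum_sq_le_of_mem_tailSet {α : ℝ} (hα : 0 < α) :
    ∃ C : ℝ, 0 < C ∧ ∀ K : ℕ, ∀ θ ∈ tailSet K, Summable (fun i => θ i ^ 2) ∧
      ∑' i, θ (i + (blockStart K - 1)) ^ 2 ≤ C * Real.exp (-(2 * α * K)) := by
  obtain ⟨C, hC, hE⟩ := exists_envelope_sq_le hα
  have hS : Summable fun i : ℕ => 1 / ((i : ℝ) + 1) ^ 2 := by
    have := (summable_nat_add_iff 1).2 (Real.summable_one_div_nat_pow.2 (one_lt_two))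
    simpa using this
  set S := ∑' i : ℕ, 1 / ((i : ℝ) + 1) ^ 2 with hSdef
  have hS0 : 0 < S := hS.tsum_pos (fun i => by positivity) 0 (by norm_num)
  refine ⟨C * 2 ^ (2 * α) * S, by positivity, fun K θ hθ => ?_⟩
  set N := blockStart K - 1 with hN
  have hl : (0 : ℝ) < blockStart K := by exact_mod_cast one_le_blockStart K
  have hb : ∀ i, θ (i + N) ^ 2 ≤
      C * 2 ^ (2 * α) * Real.exp (-(2 * α * K)) * (1 / ((i : ℝ) + 1) ^ 2) := by
    intro i
    have h1 : |θ (i + N)| ≤ envelope (i + N) := hθ _ (le_sub_one_add_one_add K i)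
    have h2 : θ (i + N) ^ 2 ≤ envelope (i + N) ^ 2 := by
      rw [← sq_abs (θ _)]
      exact pow_le_pow_left₀ (abs_nonneg _) h1 2
    have h3 : (blockStart K : ℝ) ≤ ((i + N + 1 : ℕ) : ℝ) := by
      exact_mod_cast le_sub_one_add_one_add K i
    calc θ (i + N) ^ 2 ≤ C * (((i + N + 1 : ℕ) : ℝ) ^ (-(2 * α)) *
          (1 / (((i + N : ℕ) : ℝ) + 1) ^ 2)) := h2.trans (hE _)
      _ ≤ C * ((2 ^ (2 * α) * Real.exp (-(2 * α * K))) * (1 / ((i : ℝ) + 1) ^ 2)) := by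
          gcongr
          · exact (Real.rpow_le_rpow_of_nonpos hl h3 (by linarith)).trans
              (blockStart_rpow_neg_le hα K)
          · exact_mod_cast Nat.le_add_right i N
      _ = _ := by ring
  have hs : Summable fun i => θ (i + N) ^ 2 :=
    Summable.of_nonneg_of_le (fun i => sq_nonneg _) hb (hS.mul_left _)
  refine ⟨(summable_nat_add_iff N).1 hs, ?_⟩
  calc _ ≤ ∑' i : ℕ, C * 2 ^ (2 * α) * Real.exp (-(2 * α * K)) * (1 / ((i : ℝ) + 1) ^ 2) :=
        Summable.tsum_le_tsum hb hs (hS.mul_left _)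
    _ = _ := by rw [tsum_mul_left]; ring

theorem tsum_ofReal_mul_exp (A : ℝ) (hA : 0 ≤ A) {c : ℝ} (hc : 0 < c) :
    ∑' i : ℕ, ENNReal.ofReal (A * Real.exp (-(c * i))) =
      ENNReal.ofReal (A * (1 - Real.exp (-c))⁻¹) := by
  have h1 : Real.exp (-c) < 1 := by rw [Real.exp_lt_one_iff]; linarith
  have h := (hasSum_geometric_of_lt_one (Real.exp_pos (-c)).le h1).mul_left A
  have e : ∀ i : ℕ, A * Real.exp (-(c * i)) = A * Real.exp (-c) ^ i := fun i => by
    rw [← Real.exp_nat_mul]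
    ring_nf
  simp_rw [e]
  rw [← h.tsum_eq, ENNReal.ofReal_tsum_of_nonneg (fun i => by positivity) h.summable]

theorem exists_tails_le {G : MixingDensities} (hG : G.InClass) :
    ∃ c C : ℝ, 0 < c ∧ 0 < C ∧ ∀ K : ℕ,
      ∑' k : ℕ, scaleLaw G (k + K) (Set.Iic (Real.exp (-((k + K : ℕ) : ℝ) ^ 2)))ᶜ ≤
        ENNReal.ofReal (C * Real.exp (-(c * Real.exp K))) ∧
      ∑' i : ℕ, gaussianReal 0 1 (Set.Icc (-(2 * (((i + (blockStart K - 1) : ℕ) : ℝ) + 1)))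
        (2 * (((i + (blockStart K - 1) : ℕ) : ℝ) + 1)))ᶜ ≤
        ENNReal.ofReal (C * Real.exp (-(c * Real.exp K))) := by
  obtain ⟨c₁, hc₁, htail⟩ := hG.tail
  -- The 1/2 is for the Gaussian tails: with l_K = `blockStart K`, their exponent (3/2)(i + l_K)² is
  -- at least l_K + i ≥ e^K/2 + i.
  set c := min c₁ (1 / 2) with hc
  have hc0 : 0 < c := lt_min hc₁ (by norm_num)
  have hcinv : ∀ d : ℝ, 0 < d → 0 < (1 - Real.exp (-d))⁻¹ := fun d hd => by
    have : Real.exp (-d) < 1 := by rw [Real.exp_lt_one_iff]; linarith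
    exact inv_pos.2 (by linarith)
  have hi1 := hcinv c hc0
  have hi2 := hcinv 1 one_pos
  refine ⟨c, (1 - Real.exp (-c))⁻¹ + 2 * (1 - Real.exp (-1))⁻¹, hc0, by positivity,
    fun K => ⟨?_, ?_⟩⟩
  · calc _ ≤ ∑' k : ℕ, ENNReal.ofReal (Real.exp (-(c * Real.exp K)) * Real.exp (-(c * k))) := by
          refine ENNReal.tsum_le_tsum fun k => (scaleLaw_Ioi_le htail (k + K)).trans
            (ENNReal.ofReal_le_ofReal ?_)
          rw [← Real.exp_add]
          refine Real.exp_le_exp.2 ?_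
          have h1 : Real.exp K + k ≤ Real.exp ((k + K : ℕ) : ℝ) := by
            push_cast
            rw [Real.exp_add]
            nlinarith [Real.add_one_le_exp (k : ℝ), Real.one_le_exp (Nat.cast_nonneg (α := ℝ) K),
              (Nat.cast_nonneg k : (0 : ℝ) ≤ k)]
          have h2 : c * Real.exp ((k + K : ℕ) : ℝ) ≤ c₁ * Real.exp ((k + K : ℕ) : ℝ) :=
            mul_le_mul_of_nonneg_right (min_le_left _ _) (Real.exp_pos _).le
          nlinarith
      _ = _ := tsum_ofReal_mul_exp _ (Real.exp_pos _).le hc0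
      _ ≤ _ := by
          refine ENNReal.ofReal_le_ofReal ?_
          rw [mul_comm]
          gcongr
          linarith
  · calc _ ≤ ∑' i : ℕ, ENNReal.ofReal (2 * Real.exp (-(c * Real.exp K)) * Real.exp (-(1 * i))) := by
          refine ENNReal.tsum_le_tsum fun i => (gaussianReal_compl_Icc_le _ (by positivity)).trans
            (ENNReal.ofReal_le_ofReal ?_)
          rw [mul_assoc, ← Real.exp_add]
          gcongr
          have h1 : (((i + (blockStart K - 1) : ℕ) : ℝ) + 1) = i + blockStart K := by
            rw [Nat.cast_add, Nat.cast_sub (one_le_blockStart K)]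
            push_cast
            ring
          rw [h1]
          have h2 : c * Real.exp K ≤ 1 / 2 * Real.exp K :=
            mul_le_mul_of_nonneg_right (min_le_right _ _) (Real.exp_pos _).le
          have h3 := exp_le_two_mul_blockStart K
          have h4 : (1 : ℝ) ≤ blockStart K := by exact_mod_cast one_le_blockStart K
          have h5 : (0 : ℝ) ≤ i := Nat.cast_nonneg i
          nlinarith
      _ = _ := tsum_ofReal_mul_exp _ (by positivity) one_pos
      _ ≤ _ := by
          refine ENNReal.ofReal_le_ofReal ?_
          have := Real.exp_pos (-(c * Real.exp K))
          nlinarith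

/-- The map from scales and standard normal variables to coefficients. -/
def coefMap (p : (ℕ → ℝ) × (ℕ → ℝ)) (i : ℕ) : ℝ := √(p.1 (blockIndex (i + 1))) * p.2 i

theorem measurable_coefMap : Measurable coefMap := by
  unfold coefMap
  fun_prop

theorem coefPrior_apply (G : MixingDensities) {S : Set (ℕ → ℝ)} (hS : MeasurableSet S) :
    coefPrior G S = ((Measure.infinitePi (scaleLaw G)).prod
      (Measure.infinitePi fun _ : ℕ => gaussianReal 0 1)) (coefMap ⁻¹' S) :=
  Measure.map_apply measurable_coefMap hS

theorem coefMap_mem_tailSet {K : ℕ} {p : (ℕ → ℝ) × (ℕ → ℝ)}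
    (h1 : ∀ k, K ≤ k → p.1 k ≤ Real.exp (-(k : ℝ) ^ 2))
    (h2 : ∀ i, blockStart K ≤ i + 1 → p.2 i ∈ Set.Icc (-(2 * ((i : ℝ) + 1))) (2 * ((i : ℝ) + 1))) :
    coefMap p ∈ tailSet K := by
  intro i hi
  have h3 := h1 _ (le_blockIndex hi)
  have h4 : √(p.1 (blockIndex (i + 1))) ≤ Real.exp (-((blockIndex (i + 1) : ℝ) ^ 2 / 2)) := by
    rw [Real.sqrt_le_left (Real.exp_pos _).le, ← Real.exp_nat_mul]
    refine h3.trans_eq ?_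
    congr 1
    push_cast
    ring
  have h5 : |p.2 i| ≤ 2 * ((i : ℝ) + 1) := abs_le.2 (h2 i hi)
  rw [coefMap, abs_mul, abs_of_nonneg (Real.sqrt_nonneg _), envelope, mul_comm]
  gcongr

theorem exists_coefPrior_compl_tailSet_le {G : MixingDensities} (hG : G.InClass) :
    ∃ c C : ℝ, 0 < c ∧ 0 < C ∧ ∀ K : ℕ, coefPrior G (tailSet K)ᶜ ≤
      ENNReal.ofReal (C * Real.exp (-(c * Real.exp K))) := by
  obtain ⟨c, C, hc, hC, h⟩ := exists_tails_le hG
  refine ⟨c, 2 * C, hc, by positivity, fun K => ?_⟩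
  set μA := Measure.infinitePi (scaleLaw G)
  set μZ := Measure.infinitePi fun _ : ℕ => gaussianReal 0 1
  set N := blockStart K - 1 with hN
  rw [coefPrior_apply G (measurableSet_tailSet K).compl]
  set SA : ℕ → Set ℝ := fun k => (Set.Iic (Real.exp (-((k + K : ℕ) : ℝ) ^ 2)))ᶜ with hSA
  set SZ : ℕ → Set ℝ := fun i => (Set.Icc (-(2 * (((i + N : ℕ) : ℝ) + 1)))
    (2 * (((i + N : ℕ) : ℝ) + 1)))ᶜ with hSZ
  have hsub : coefMap ⁻¹' (tailSet K)ᶜ ⊆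
      (⋃ k, (fun p : (ℕ → ℝ) × (ℕ → ℝ) => p.1 (k + K)) ⁻¹' SA k) ∪
      ⋃ i, (fun p : (ℕ → ℝ) × (ℕ → ℝ) => p.2 (i + N)) ⁻¹' SZ i := by
    intro p hp
    by_contra hcon
    simp only [Set.mem_union, Set.mem_iUnion, Set.mem_preimage, hSA, hSZ, Set.mem_compl_iff,
      not_or, not_exists, not_not] at hcon
    refine hp (coefMap_mem_tailSet (fun k hk => ?_) fun i hi => ?_)
    · have := hcon.1 (k - K)
      rwa [Nat.sub_add_cancel hk] at this
    · have := hcon.2 (i - N)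
      rwa [Nat.sub_add_cancel (by omega : N ≤ i)] at this
  have e1 : ∀ k, (μA.prod μZ) ((fun p : (ℕ → ℝ) × (ℕ → ℝ) => p.1 (k + K)) ⁻¹' SA k) =
      scaleLaw G (k + K) (SA k) := by
    intro k
    have hm : MeasurableSet (SA k) := measurableSet_Iic.compl
    have : (fun p : (ℕ → ℝ) × (ℕ → ℝ) => p.1 (k + K)) ⁻¹' SA k =
        Prod.fst ⁻¹' ((fun a : ℕ → ℝ => a (k + K)) ⁻¹' SA k) := rfl
    rw [this, measurePreserving_fst.measure_preimage
      ((measurable_pi_apply (k + K)) hm).nullMeasurableSet,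
      ← Measure.map_apply (measurable_pi_apply (k + K)) hm, Measure.infinitePi_map_eval]
  have e2 : ∀ i, (μA.prod μZ) ((fun p : (ℕ → ℝ) × (ℕ → ℝ) => p.2 (i + N)) ⁻¹' SZ i) =
      gaussianReal 0 1 (SZ i) := by
    intro i
    have hm : MeasurableSet (SZ i) := measurableSet_Icc.compl
    have : (fun p : (ℕ → ℝ) × (ℕ → ℝ) => p.2 (i + N)) ⁻¹' SZ i =
        Prod.snd ⁻¹' ((fun a : ℕ → ℝ => a (i + N)) ⁻¹' SZ i) := rfl
    rw [this, measurePreserving_snd.measure_preimage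
      ((measurable_pi_apply (i + N)) hm).nullMeasurableSet,
      ← Measure.map_apply (measurable_pi_apply (i + N)) hm, Measure.infinitePi_map_eval]
  calc _ ≤ _ := (measure_mono hsub).trans (measure_union_le _ _)
    _ ≤ (∑' k, scaleLaw G (k + K) (SA k)) + ∑' i, gaussianReal 0 1 (SZ i) := by
        refine add_le_add ((measure_iUnion_le _).trans_eq ?_) ((measure_iUnion_le _).trans_eq ?_)
        · exact tsum_congr e1
        · exact tsum_congr e2
    _ ≤ ENNReal.ofReal (C * Real.exp (-(c * Real.exp K))) +
          ENNReal.ofReal (C * Real.exp (-(c * Real.exp K))) := add_le_add (h K).1 (h K).2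
    _ = _ := by
        rw [← ENNReal.ofReal_add (by positivity) (by positivity)]
        ring_nf

theorem tendsto_exp_neg_mul_exp {c : ℝ} (hc : 0 < c) (C : ℝ) :
    Tendsto (fun K : ℕ => C * Real.exp (-(c * Real.exp K))) atTop (𝓝 0) := by
  rw [← mul_zero C]
  refine Tendsto.const_mul C (Real.tendsto_exp_neg_atTop_nhds_zero.comp ?_)
  exact (Real.tendsto_exp_atTop.comp tendsto_natCast_atTop_atTop).const_mul_atTop hc

/-- Non-summable sequences lie outside every `tailSet K`, and the mass of the complements tends to
0. -/
theorem ae_summable_sq {G : MixingDensities} (hG : G.InClass) :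
    ∀ᵐ θ ∂(coefPrior G), Summable fun i => θ i ^ 2 := by
  obtain ⟨c, C, hc, hC, h⟩ := exists_coefPrior_compl_tailSet_le hG
  obtain ⟨C', -, h'⟩ := exists_tsum_sq_le_of_mem_tailSet one_pos
  have hle : ∀ K : ℕ, coefPrior G {θ | ¬ Summable fun i => θ i ^ 2} ≤
      ENNReal.ofReal (C * Real.exp (-(c * Real.exp K))) := by
    intro K
    have hsub : {θ : ℕ → ℝ | ¬ Summable fun i => θ i ^ 2} ⊆ (tailSet K)ᶜ := by
      intro θ hθ hmem
      exact hθ (h' K θ hmem).1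
    exact (measure_mono hsub).trans (h K)
  have hlim : Tendsto (fun K : ℕ => ENNReal.ofReal (C * Real.exp (-(c * Real.exp K)))) atTop
      (𝓝 0) := by
    have := (ENNReal.continuous_ofReal.tendsto 0).comp (tendsto_exp_neg_mul_exp hc C)
    rwa [ENNReal.ofReal_zero] at this
  exact ae_iff.2 (le_antisymm (ge_of_tendsto' hlim hle) zero_le)

theorem aemeasurable_synthesis {G : MixingDensities} (hG : G.InClass) :
    AEMeasurable synthesis (coefPrior G) := by
  refine aemeasurable_of_tendsto_metrizable_ae atTop
    (f := fun (n : ℕ) (θ : ℕ → ℝ) => ∑ i ∈ Finset.range n, θ i • trigL2 (i + 1)) (fun n => ?_) ?_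
  · refine Measurable.aemeasurable (Finset.measurable_sum _ fun i _ => ?_)
    exact (measurable_pi_apply i).smul_const _
  · filter_upwards [ae_summable_sq hG] with θ hθ
    exact (hasSum_synthesis hθ).tendsto_sum_nat

/-! ### The prior mass of small balls -/

/-- This is the logarithm of X^N / N! ≤ e^X at X = e^K. It keeps the logarithmic cost of the small
balls at order e^K, where a termwise bound by K would give K e^K and spoil the rate. -/
theorem sum_range_sub_log_le (N K : ℕ) :
    ∑ i ∈ Finset.range N, ((K : ℝ) - Real.log ((i : ℝ) + 1)) ≤ Real.exp K := by
  have h1 := Real.pow_div_factorial_le_exp (Real.exp K) (Real.exp_pos _).le N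
  have h2 := Real.log_le_log (by positivity) h1
  rw [Real.log_exp, Real.log_div (by positivity) (by positivity), Real.log_pow, Real.log_exp] at h2
  have h3 : Real.log (N.factorial : ℝ) = ∑ i ∈ Finset.range N, Real.log ((i : ℝ) + 1) := by
    rw [← Finset.prod_range_add_one_eq_factorial, Nat.cast_prod, Real.log_prod]
    · push_cast
      rfl
    · intro i _
      positivity
  rw [Finset.sum_sub_distrib, ← h3]
  simpa using h2

theorem sum_range_exp_le (K : ℕ) : ∑ k ∈ Finset.range K, Real.exp k ≤ Real.exp K := by
  induction K with
  | zero => simp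
  | succ K ih =>
    rw [Finset.sum_range_succ]
    push_cast
    rw [Real.exp_add]
    nlinarith [Real.add_one_le_exp (1 : ℝ), Real.exp_pos (K : ℝ)]

theorem blockStart_sub_one_le_exp (K : ℕ) : ((blockStart K - 1 : ℕ) : ℝ) ≤ Real.exp K :=
  (Nat.cast_le.2 (Nat.sub_le _ _)).trans (blockStart_le_exp K)

/-- With j = i + 1 in the block `B_k`, 1/a is of order e^{(2α+1)k}, hence of order j^{2α+1} ≤ j^{2α}
e^K. So θ²/a is controlled by the Sobolev norm, δ²/a is bounded, and log(a/δ²) is at most (2α+1)(K -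
log j) up to a constant. -/
theorem head_exponent_le {α m : ℝ} (hα : 0 < α) (hm : 1 ≤ m) {K i : ℕ}
    (hi : i < blockStart K - 1) {a : ℝ}
    (ha : a ∈ Set.Icc (Real.exp (-((2 * α + 1) * blockIndex (i + 1))) / m)
      (m * Real.exp (-((2 * α + 1) * blockIndex (i + 1))))) (θ : ℝ) :
    (θ ^ 2 + Real.exp (-((2 * α + 1) * K / 2)) ^ 2) / a + 1 +
        Real.log (a / Real.exp (-((2 * α + 1) * K / 2)) ^ 2) / 2 ≤
      m * 2 ^ (2 * α + 1) * Real.exp K * (((i + 1 : ℕ) : ℝ) ^ (2 * α) * θ ^ 2) +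
        (2 * m + 1 + (2 * α + 1) / 2) +
        (2 * α + 1) / 2 * ((K : ℝ) - Real.log ((i : ℝ) + 1)) := by
  set β := 2 * α + 1 with hβ
  set k := blockIndex (i + 1) with hk
  have hβ0 : 0 < β := by linarith
  have hm0 : 0 < m := by linarith
  have ha0 : 0 < a := lt_of_lt_of_le (by positivity) ha.1
  have hj : (0 : ℝ) < ((i + 1 : ℕ) : ℝ) := by positivity
  have hjX : ((i + 1 : ℕ) : ℝ) ≤ Real.exp K :=
    (Nat.cast_le.2 (by omega)).trans (blockStart_sub_one_le_exp K)
  have hkK : (k : ℝ) ≤ K := by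
    have : k < K := blockIndex_lt (by omega) (by omega)
    exact_mod_cast this.le
  have hδ : Real.exp (-(β * K / 2)) ^ 2 = Real.exp (-(β * K)) := by
    rw [← Real.exp_nat_mul]
    congr 1
    push_cast
    ring
  have hinv : 1 / a ≤ m * Real.exp (β * k) := by
    rw [div_le_iff₀ ha0]
    have h1 := ha.1
    rw [div_le_iff₀ hm0, Real.exp_neg] at h1
    have h2 := mul_le_mul_of_nonneg_left h1 (Real.exp_pos (β * k)).le
    rw [mul_inv_cancel₀ (Real.exp_pos _).ne'] at h2
    linarith
  have hpow : Real.exp (β * k) ≤ 2 ^ β * Real.exp K * ((i + 1 : ℕ) : ℝ) ^ (2 * α) := by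
    calc Real.exp (β * k) = Real.exp k ^ β := by rw [← Real.exp_mul, mul_comm]
      _ ≤ (2 * ((i + 1 : ℕ) : ℝ)) ^ β :=
          Real.rpow_le_rpow (Real.exp_pos _).le (exp_blockIndex_le (by omega)) hβ0.le
      _ = 2 ^ β * (((i + 1 : ℕ) : ℝ) ^ (2 * α) * ((i + 1 : ℕ) : ℝ)) := by
          rw [Real.mul_rpow (by norm_num) hj.le, hβ, Real.rpow_add_one hj.ne']
      _ ≤ 2 ^ β * (((i + 1 : ℕ) : ℝ) ^ (2 * α) * Real.exp K) := by gcongr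
      _ = _ := by ring
  have hθ : θ ^ 2 / a ≤
      m * 2 ^ β * Real.exp K * (((i + 1 : ℕ) : ℝ) ^ (2 * α) * θ ^ 2) := by
    calc θ ^ 2 / a = 1 / a * θ ^ 2 := by ring
      _ ≤ m * (2 ^ β * Real.exp K * ((i + 1 : ℕ) : ℝ) ^ (2 * α)) * θ ^ 2 := by
          gcongr
          exact hinv.trans (by gcongr)
      _ = _ := by ring
  have hδa : Real.exp (-(β * K)) / a ≤ m := by
    calc Real.exp (-(β * K)) / a = 1 / a * Real.exp (-(β * K)) := by ring
      _ ≤ m * Real.exp (β * k) * Real.exp (-(β * K)) := by gcongr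
      _ = m * Real.exp (-(β * (K - k))) := by
          rw [mul_assoc, ← Real.exp_add]
          ring_nf
      _ ≤ m * 1 := by
          gcongr
          rw [Real.exp_le_one_iff]
          nlinarith
      _ = m := mul_one m
  have hlog : Real.log (a / Real.exp (-(β * K))) ≤
      m + β * (K - Real.log ((i : ℝ) + 1) + 1) := by
    have h1 : a / Real.exp (-(β * K)) ≤ m * Real.exp (β * (K - k)) := by
      rw [div_le_iff₀ (Real.exp_pos _), mul_assoc, ← Real.exp_add]
      refine ha.2.trans_eq ?_
      ring_nf
    have h2 := Real.log_le_log (by positivity) h1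
    rw [Real.log_mul hm0.ne' (Real.exp_pos _).ne', Real.log_exp] at h2
    have h3 : Real.log m ≤ m := Real.log_le_self hm0.le
    have h4 : Real.log ((i : ℝ) + 1) ≤ k + 1 := by
      have := Real.log_le_log hj (le_exp_blockIndex_add_one (j := i + 1) (by omega))
      rw [Real.log_exp] at this
      push_cast at this
      exact this
    nlinarith
  rw [hδ, add_div]
  linarith

theorem sum_head_exponent_le {α Q m : ℝ} (hα : 0 < α) (hm : 1 ≤ m) {f : Signal}
    (hf : f ∈ sobolevBall α Q) (K : ℕ) {a : ℕ → ℝ}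
    (ha : ∀ k < K, a k ∈ Set.Icc (Real.exp (-((2 * α + 1) * k)) / m)
      (m * Real.exp (-((2 * α + 1) * k)))) :
    ∑ i ∈ Finset.range (blockStart K - 1),
        ((fourierCoef f (i + 1) ^ 2 + Real.exp (-((2 * α + 1) * K / 2)) ^ 2) /
          a (blockIndex (i + 1)) + 1 +
        Real.log (a (blockIndex (i + 1)) / Real.exp (-((2 * α + 1) * K / 2)) ^ 2) / 2) ≤
      (m * 2 ^ (2 * α + 1) * Q ^ 2 + 2 * m + 1 + (2 * α + 1)) * Real.exp K := by
  set β := 2 * α + 1 with hβ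
  set N := blockStart K - 1 with hN
  have hX := Real.exp_pos (K : ℝ)
  calc _ ≤ ∑ i ∈ Finset.range N,
        (m * 2 ^ β * Real.exp K * (((i + 1 : ℕ) : ℝ) ^ (2 * α) * fourierCoef f (i + 1) ^ 2) +
          (2 * m + 1 + β / 2) + β / 2 * ((K : ℝ) - Real.log ((i : ℝ) + 1))) := by
        refine Finset.sum_le_sum fun i hi => ?_
        have hi' := Finset.mem_range.1 hi
        exact head_exponent_le hα hm hi' (ha _ (blockIndex_lt (by omega) (by omega))) _
    _ = m * 2 ^ β * Real.exp K * (∑ i ∈ Finset.range N,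
          ((i + 1 : ℕ) : ℝ) ^ (2 * α) * fourierCoef f (i + 1) ^ 2) +
        N * (2 * m + 1 + β / 2) +
        β / 2 * ∑ i ∈ Finset.range N, ((K : ℝ) - Real.log ((i : ℝ) + 1)) := by
        rw [Finset.sum_add_distrib, Finset.sum_add_distrib, Finset.mul_sum, Finset.mul_sum,
          Finset.sum_const, Finset.card_range, nsmul_eq_mul]
    _ ≤ m * 2 ^ β * Real.exp K * Q ^ 2 + Real.exp K * (2 * m + 1 + β / 2) +
        β / 2 * Real.exp K := by
        gcongr
        · exact sum_rpow_mul_sq_le_of_mem_sobolevBall hf _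
        · exact blockStart_sub_one_le_exp K
        · exact sum_range_sub_log_le N K
    _ = _ := by ring

theorem le_infinitePi_of_sum_le {X : ℕ → Type*} [∀ i, MeasurableSpace (X i)]
    (μ : ∀ i, Measure (X i)) [∀ i, IsProbabilityMeasure (μ i)] {S : ∀ i, Set (X i)}
    (hS : ∀ i, MeasurableSet (S i)) {N : ℕ} {e : ℕ → ℝ} {E : ℝ}
    (he : ∀ i < N, ENNReal.ofReal (Real.exp (-e i)) ≤ μ i (S i))
    (hE : ∑ i ∈ Finset.range N, e i ≤ E)
    (ht : ∑' i, μ (i + N) (S (i + N))ᶜ ≤ ENNReal.ofReal (1 / 2)) :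
    ENNReal.ofReal (Real.exp (-E) / 2) ≤ Measure.infinitePi μ (Set.univ.pi S) := by
  refine le_trans ?_ (prod_mul_one_sub_tsum_le_infinitePi μ hS N)
  rw [div_eq_mul_one_div, ENNReal.ofReal_mul (Real.exp_pos _).le]
  gcongr
  · calc ENNReal.ofReal (Real.exp (-E))
        ≤ ENNReal.ofReal (∏ i ∈ Finset.range N, Real.exp (-e i)) := by
          rw [← Real.exp_sum, Finset.sum_neg_distrib]
          gcongr
      _ = ∏ i ∈ Finset.range N, ENNReal.ofReal (Real.exp (-e i)) :=
          ENNReal.ofReal_prod_of_nonneg fun i _ => (Real.exp_pos _).le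
      _ ≤ _ := Finset.prod_le_prod' fun i hi => he i (Finset.mem_range.1 hi)
  · calc ENNReal.ofReal (1 / 2) = 1 - ENNReal.ofReal (1 / 2) := by
          rw [← ENNReal.ofReal_one, ← ENNReal.ofReal_sub _ (by norm_num)]
          norm_num
      _ ≤ _ := tsub_le_tsub_left ht 1

/-- The coefficient sequences that are close to those of `f` before the block `B_K`, and bounded
by the envelope from the block `B_K` on. -/
def nearSet (α : ℝ) (f : Signal) (K : ℕ) : Set (ℕ → ℝ) :=
  {θ | ∀ i < blockStart K - 1, |θ i - fourierCoef f (i + 1)| ≤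
    Real.exp (-((2 * α + 1) * K / 2))} ∩ tailSet K

theorem measurableSet_nearSet (α : ℝ) (f : Signal) (K : ℕ) : MeasurableSet (nearSet α f K) := by
  refine MeasurableSet.inter ?_ (measurableSet_tailSet K)
  simp only [Set.ofPred_forall]
  refine MeasurableSet.iInter fun i => MeasurableSet.iInter fun _ => ?_
  exact measurableSet_le ((measurable_pi_apply i).sub_const _).abs measurable_const

/-- The argument conditions on the scales: the bound for the normal variables is uniform over the
good set of scales, so Fubini multiplies the two probabilities. -/
theorem exists_le_coefPrior_nearSet {G : MixingDensities} (hG : G.InClass) {α : ℝ} (hα : 0 < α)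
    (Q : ℝ) :
    ∃ C : ℝ, 0 < C ∧ ∀ᶠ K : ℕ in atTop, ∀ f ∈ sobolevBall α Q,
      ENNReal.ofReal (Real.exp (-(C * Real.exp K))) ≤ coefPrior G (nearSet α f K) := by
  obtain ⟨m, hm, hscale⟩ := exists_scaleLaw_Icc_ge hG (show 1 ≤ 2 * α + 1 by linarith)
  obtain ⟨c, C, hc, hC, htail⟩ := exists_tails_le hG
  set D := m * 2 ^ (2 * α + 1) * Q ^ 2 + 2 * m + 1 + (2 * α + 1) with hD
  have hm0 : 0 < m := by linarith
  have hD0 : 0 < D := by positivity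
  -- The scales cost m and the normal variables cost D. The 2 absorbs the factor 1/2 lost to the
  -- tails in each of the two products.
  refine ⟨m + D + 2, by positivity, ?_⟩
  filter_upwards [(tendsto_exp_neg_mul_exp hc C).eventually_le_const
    (show (0 : ℝ) < 1 / 2 by norm_num)] with K hK f hf
  set N := blockStart K - 1 with hN
  set β := 2 * α + 1 with hβ
  set δ := Real.exp (-(β * K / 2)) with hδ
  have htail1 := (htail K).1.trans (ENNReal.ofReal_le_ofReal hK)
  have htail2 := (htail K).2.trans (ENNReal.ofReal_le_ofReal hK)
  set SA : ℕ → Set ℝ := fun k => if k < K then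
    Set.Icc (Real.exp (-(β * k)) / m) (m * Real.exp (-(β * k)))
    else Set.Iic (Real.exp (-(k : ℝ) ^ 2)) with hSA
  set SZ : (ℕ → ℝ) → ℕ → Set ℝ := fun a i => if i < N then
    {z | |√(a (blockIndex (i + 1))) * z - fourierCoef f (i + 1)| ≤ δ}
    else Set.Icc (-(2 * ((i : ℝ) + 1))) (2 * ((i : ℝ) + 1)) with hSZ
  have hSAm : ∀ k, MeasurableSet (SA k) := by
    intro k
    simp only [hSA]
    split_ifs
    · exact measurableSet_Icc
    · exact measurableSet_Iic
  have hSZm : ∀ a i, MeasurableSet (SZ a i) := by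
    intro a i
    simp only [hSZ]
    split_ifs
    · exact measurableSet_le (by fun_prop) measurable_const
    · exact measurableSet_Icc
  have hA : ENNReal.ofReal (Real.exp (-(m * Real.exp K)) / 2) ≤
      Measure.infinitePi (scaleLaw G) (Set.univ.pi SA) := by
    refine le_infinitePi_of_sum_le (scaleLaw G) hSAm (N := K) (e := fun k => m * Real.exp k)
      (fun k hk => ?_) ?_ ?_
    · simp only [hSA, if_pos hk]
      exact hscale k
    · rw [← Finset.mul_sum]
      gcongr
      exact sum_range_exp_le K
    · refine le_trans (le_of_eq (tsum_congr fun k => ?_)) htail1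
      simp only [hSA, if_neg (show ¬ k + K < K by omega)]
  have hZ : ∀ a ∈ Set.univ.pi SA, ENNReal.ofReal (Real.exp (-(D * Real.exp K)) / 2) ≤
      Measure.infinitePi (fun _ : ℕ => gaussianReal 0 1) (Set.univ.pi (SZ a)) := by
    intro a ha
    have ha' : ∀ k < K, a k ∈ Set.Icc (Real.exp (-(β * k)) / m) (m * Real.exp (-(β * k))) := by
      intro k hk
      have := ha k (Set.mem_univ k)
      simpa only [hSA, if_pos hk] using this
    refine le_infinitePi_of_sum_le _ (hSZm a) (N := N) (fun i hi => ?_)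
      (sum_head_exponent_le hα hm hf K ha') ?_
    · simp only [hSZ, if_pos hi]
      refine le_gaussianReal_near ?_ (Real.exp_pos _) _
      exact lt_of_lt_of_le (by positivity) (ha' _ (blockIndex_lt (by omega) (by omega))).1
    · refine le_trans (le_of_eq (tsum_congr fun i => ?_)) htail2
      simp only [hSZ, if_neg (show ¬ i + N < N by omega)]
      rfl
  have hsub : ∀ a ∈ Set.univ.pi SA, Set.univ.pi (SZ a) ⊆
      Prod.mk a ⁻¹' (coefMap ⁻¹' nearSet α f K) := by
    intro a ha z hz
    refine ⟨fun i hi => ?_, coefMap_mem_tailSet (fun k hk => ?_) fun i hi => ?_⟩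
    · have := hz i (Set.mem_univ i)
      simp only [hSZ, if_pos (show i < N from hi)] at this
      exact this
    · have := ha k (Set.mem_univ k)
      simp only [hSA, if_neg (show ¬ k < K by omega)] at this
      exact this
    · have := hz i (Set.mem_univ i)
      simp only [hSZ, if_neg (show ¬ i < N by omega)] at this
      exact this
  rw [coefPrior_apply G (measurableSet_nearSet α f K),
    Measure.prod_apply (measurable_coefMap (measurableSet_nearSet α f K))]
  calc ENNReal.ofReal (Real.exp (-((m + D + 2) * Real.exp K)))
      ≤ ENNReal.ofReal (Real.exp (-(D * Real.exp K)) / 2 * (Real.exp (-(m * Real.exp K)) / 2)) := by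
        refine ENNReal.ofReal_le_ofReal ?_
        have h1 : Real.exp (-(2 * Real.exp K)) ≤ 1 / 4 := by
          have h2 : Real.exp (-(Real.exp K)) ≤ 1 / 2 := by
            have h3 : (2 : ℝ) ≤ Real.exp (Real.exp K) := by
              have := Real.one_le_exp (Nat.cast_nonneg (α := ℝ) K)
              linarith [Real.add_one_le_exp (Real.exp K)]
            rw [Real.exp_neg, one_div]
            exact inv_anti₀ (by norm_num) h3
          have h4 : Real.exp (-(2 * Real.exp K)) = Real.exp (-(Real.exp K)) ^ 2 := by
            rw [← Real.exp_nat_mul]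
            congr 1
            push_cast
            ring
          rw [h4]
          nlinarith [Real.exp_pos (-(Real.exp K))]
        calc Real.exp (-((m + D + 2) * Real.exp K)) = Real.exp (-(D * Real.exp K)) *
              Real.exp (-(m * Real.exp K)) * Real.exp (-(2 * Real.exp K)) := by
              rw [← Real.exp_add, ← Real.exp_add]
              ring_nf
          _ ≤ Real.exp (-(D * Real.exp K)) * Real.exp (-(m * Real.exp K)) * (1 / 4) := by gcongr
          _ = _ := by ring
    _ = ENNReal.ofReal (Real.exp (-(D * Real.exp K)) / 2) *
          ENNReal.ofReal (Real.exp (-(m * Real.exp K)) / 2) := ENNReal.ofReal_mul (by positivity)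
    _ ≤ ENNReal.ofReal (Real.exp (-(D * Real.exp K)) / 2) *
          Measure.infinitePi (scaleLaw G) (Set.univ.pi SA) := by gcongr
    _ = ∫⁻ _ in Set.univ.pi SA, ENNReal.ofReal (Real.exp (-(D * Real.exp K)) / 2)
          ∂(Measure.infinitePi (scaleLaw G)) := (setLIntegral_const _ _).symm
    _ ≤ ∫⁻ a in Set.univ.pi SA, Measure.infinitePi (fun _ : ℕ => gaussianReal 0 1)
          (Prod.mk a ⁻¹' (coefMap ⁻¹' nearSet α f K)) ∂(Measure.infinitePi (scaleLaw G)) :=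
        setLIntegral_mono' (MeasurableSet.univ_pi hSAm) fun a ha =>
          (hZ a ha).trans (measure_mono (hsub a ha))
    _ ≤ _ := setLIntegral_le_lintegral _ _

theorem tailEnergy_synthesis {θ : ℕ → ℝ} (hθ : Summable fun i => θ i ^ 2) (N : ℕ) :
    tailEnergy N (synthesis θ) = ∑' i, θ (i + N) ^ 2 :=
  tsum_congr fun i => by rw [fourierCoef_synthesis hθ]

theorem exists_norm_synthesis_sub_sq_le {α : ℝ} (hα : 0 < α) (Q : ℝ) :
    ∃ C : ℝ, 0 < C ∧ ∀ K : ℕ, ∀ f ∈ sobolevBall α Q, ∀ θ ∈ nearSet α f K,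
      ‖synthesis θ - f‖ ^ 2 ≤ C * Real.exp (-(2 * α * K)) := by
  obtain ⟨C, hC, h⟩ := exists_tsum_sq_le_of_mem_tailSet hα
  refine ⟨1 + 2 * C + 2 * (2 ^ (2 * α) * Q ^ 2), by positivity, fun K f hf θ hθ => ?_⟩
  obtain ⟨hsum, htail⟩ := h K θ hθ.2
  have h1 := tailEnergy_eq (blockStart K - 1) (synthesis θ - f)
  have h2 := tailEnergy_sub_le (blockStart K - 1) (synthesis θ) f
  rw [tailEnergy_synthesis hsum] at h2
  have h3 := tailEnergy_le_of_mem_sobolevBall hα hf K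
  -- At most e^K coefficients, each with squared error at most e^{-(2α+1)K}: this is what fixes the
  -- accuracy in `nearSet`.
  have h4 : ∑ i ∈ Finset.range (blockStart K - 1), fourierCoef (synthesis θ - f) (i + 1) ^ 2 ≤
      Real.exp (-(2 * α * K)) := by
    calc _ ≤ ∑ i ∈ Finset.range (blockStart K - 1), Real.exp (-((2 * α + 1) * K)) := by
          refine Finset.sum_le_sum fun i hi => ?_
          rw [fourierCoef_sub, fourierCoef_synthesis hsum, ← sq_abs]
          refine (pow_le_pow_left₀ (abs_nonneg _) (hθ.1 i (Finset.mem_range.1 hi)) 2).trans_eq ?_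
          rw [← Real.exp_nat_mul]
          congr 1
          push_cast
          ring
      _ = ((blockStart K - 1 : ℕ) : ℝ) * Real.exp (-((2 * α + 1) * K)) := by
          rw [Finset.sum_const, Finset.card_range, nsmul_eq_mul]
      _ ≤ Real.exp K * Real.exp (-((2 * α + 1) * K)) := by
          gcongr
          exact blockStart_sub_one_le_exp K
      _ = _ := by
          rw [← Real.exp_add]
          ring_nf
  linarith

theorem blockPrior_apply {G : MixingDensities} (hG : G.InClass) {S : Set Signal}
    (hS : MeasurableSet S) : blockPrior G S = coefPrior G (synthesis ⁻¹' S) :=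
  Measure.map_apply_of_aemeasurable (aemeasurable_synthesis hG) hS

theorem blockPrior_le_one {G : MixingDensities} (hG : G.InClass) (S : Set Signal) :
    blockPrior G S ≤ 1 := by
  refine (measure_mono (Set.subset_univ S)).trans ?_
  rw [blockPrior_apply hG MeasurableSet.univ, coefPrior_apply G (by simp)]
  exact prob_le_one

/-- The block prior charges balls around the points of a Sobolev ball, and gives little mass to
signals with a large tail. -/
theorem exists_blockPrior_bounds {G : MixingDensities} (hG : G.InClass) {α : ℝ} (hα : 0 < α)
    (Q : ℝ) : ∃ B C₁ C₂ c : ℝ, 0 < B ∧ 0 < C₁ ∧ 0 < C₂ ∧ 0 < c ∧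
      (∀ᶠ K : ℕ in atTop, ∀ f₀ ∈ sobolevBall α Q,
        ENNReal.ofReal (Real.exp (-(C₁ * Real.exp K))) ≤
          blockPrior G {f | ‖f - f₀‖ ^ 2 ≤ B * Real.exp (-(2 * α * K))}) ∧
      (∀ K : ℕ, blockPrior G {f | B * Real.exp (-(2 * α * K)) < tailEnergy (blockStart K - 1) f} ≤
        ENNReal.ofReal (C₂ * Real.exp (-(c * Real.exp K)))) ∧
      ∀ K : ℕ, ∀ f₀ ∈ sobolevBall α Q,
        tailEnergy (blockStart K - 1) f₀ ≤ B * Real.exp (-(2 * α * K)) := by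
  obtain ⟨B₁, hB₁, hb⟩ := exists_norm_synthesis_sub_sq_le hα Q
  obtain ⟨B₂, hB₂, ht⟩ := exists_tsum_sq_le_of_mem_tailSet hα
  obtain ⟨C₁, hC₁, h₁⟩ := exists_le_coefPrior_nearSet hG hα Q
  obtain ⟨c, C₂, hc, hC₂, h₂⟩ := exists_coefPrior_compl_tailSet_le hG
  refine ⟨B₁ + B₂ + 2 ^ (2 * α) * Q ^ 2, C₁, C₂, c, by positivity, hC₁, hC₂, hc, ?_, ?_, ?_⟩
  · filter_upwards [h₁] with K hK f₀ hf₀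
    refine (hK f₀ hf₀).trans ?_
    rw [blockPrior_apply hG (measurableSet_le (by fun_prop) measurable_const)]
    refine measure_mono fun θ hθ => (hb K f₀ hf₀ θ hθ).trans ?_
    gcongr
    have : 0 ≤ 2 ^ (2 * α) * Q ^ 2 := by positivity
    linarith
  · intro K
    refine le_trans ?_ (h₂ K)
    rw [blockPrior_apply hG
      (measurableSet_lt measurable_const (continuous_tailEnergy _).measurable)]
    refine measure_mono fun θ hθ hmem => ?_
    refine absurd (show _ < tailEnergy _ (synthesis θ) from hθ) (not_lt.2 ?_)
    obtain ⟨hs, hle⟩ := ht K θ hmem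
    rw [tailEnergy_synthesis hs]
    refine hle.trans ?_
    gcongr
    have : 0 ≤ 2 ^ (2 * α) * Q ^ 2 := by positivity
    linarith
  · intro K f₀ hf₀
    refine (tailEnergy_le_of_mem_sobolevBall hα hf₀ K).trans ?_
    gcongr
    linarith

/-! ### Contraction -/

/-- The map to the uncountable product is not covered by coordinatewise measurability, since
uncountably many null sets would have to be discarded. Continuity of the paths reduces them to those
of a countable dense set of times. Without this the `Measure.map` in `pathLaw` could be the default
value 0. -/
theorem aemeasurable_path {Ω : Type*} [MeasurableSpace Ω] {P : Measure Ω} {W : ℝ≥0 → Ω → ℝ}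
    (hW : IsBrownianReal W P) :
    AEMeasurable (fun ω (t : unitInterval) => W (unitInterval.toNNReal t) ω) P := by
  have hae : ∀ t, AEMeasurable (W t) P := fun t => hW.toIsPreBrownianReal.aemeasurable t
  have hd := TopologicalSpace.exists_countable_dense unitInterval
  obtain ⟨D, hDc, hDd⟩ := hd
  have := hDc.to_subtype
  have hgood : ∀ᵐ ω ∂P, Continuous (fun t => W t ω) ∧
      ∀ q : D, W (unitInterval.toNNReal q) ω = (hae (unitInterval.toNNReal q)).mk _ ω :=
    hW.cont.and (ae_all_iff.2 fun q => (hae _).ae_eq_mk)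
  obtain ⟨S, hS, hSm, hSP⟩ := exists_measurable_superset_of_null (ae_iff.1 hgood)
  refine ⟨fun ω t => Sᶜ.indicator (W (unitInterval.toNNReal t)) ω,
    measurable_pi_lambda _ fun t => ?_, ?_⟩
  · obtain ⟨q, hqD, hq⟩ := mem_closure_iff_seq_limit.1 (hDd t)
    refine measurable_of_tendsto_metrizable (f := fun n : ℕ =>
      Sᶜ.indicator ((hae (unitInterval.toNNReal (q n))).mk _))
      (fun n => (hae _).measurable_mk.indicator hSm.compl) ?_
    refine tendsto_pi_nhds.2 fun ω => ?_
    by_cases hω : ω ∈ Sᶜ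
    · have hg := not_not.1 fun h => hω (hS h)
      simp only [Set.indicator_of_mem hω]
      have h1 : Tendsto (fun n => W (unitInterval.toNNReal (q n)) ω) atTop
          (𝓝 (W (unitInterval.toNNReal t) ω)) :=
        ((hg.1.comp unitInterval.toNNReal_continuous).tendsto t).comp hq
      refine h1.congr fun n => ?_
      exact hg.2 ⟨q n, hqD n⟩
    · simp only [Set.indicator_of_notMem hω]
      exact tendsto_const_nhds
  · filter_upwards [measure_eq_zero_iff_ae_notMem.1 hSP] with ω hω
    ext t
    rw [Set.indicator_of_mem (show ω ∈ Sᶜ from hω)]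

theorem whiteNoise_le_one {Ω : Type*} [MeasurableSpace Ω] {P : Measure Ω} [IsProbabilityMeasure P]
    {W : ℝ≥0 → Ω → ℝ} (hμ : IsIsonormal (pathLaw P W)) (n : ℕ) (f : Signal)
    (D : Set (unitInterval → ℝ)) : whiteNoise P W n f D ≤ 1 := by
  have := hμ.isProbabilityMeasure
  refine (measure_mono (Set.subset_univ D)).trans ?_
  rw [whiteNoise_apply P W n f MeasurableSet.univ]
  exact prob_le_one

theorem setLIntegral_le_measure_add {Θ : Type*} [MeasurableSpace Θ] {μ : Measure Θ}
    (hμ : μ Set.univ ≤ 1) {A T : Set Θ} (hA : MeasurableSet A) (hT : MeasurableSet T)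
    {g : Θ → ℝ≥0∞} (hg : ∀ θ, g θ ≤ 1) {η : ℝ≥0∞} (h : ∀ θ ∈ A, θ ∉ T → g θ ≤ η) :
    ∫⁻ θ in A, g θ ∂μ ≤ μ T + η := by
  calc ∫⁻ θ in A, g θ ∂μ ≤ ∫⁻ θ in A, (T.indicator 1 θ + η) ∂μ := by
        refine setLIntegral_mono' hA fun θ hθ => ?_
        by_cases hT' : θ ∈ T
        · rw [Set.indicator_of_mem hT']
          exact (hg θ).trans le_self_add
        · rw [Set.indicator_of_notMem hT', zero_add]
          exact h θ hθ hT'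
    _ ≤ ∫⁻ θ, (T.indicator 1 θ + η) ∂μ := setLIntegral_le_lintegral _ _
    _ = μ T + η * μ Set.univ := by
        rw [lintegral_add_right _ measurable_const, lintegral_indicator_one hT, lintegral_const]
    _ ≤ μ T + η := by
        gcongr
        exact mul_le_of_le_one_right' hμ

theorem exp_neg_le_half {x : ℝ} (hx : 1 ≤ x) : Real.exp (-x) ≤ 1 / 2 := by
  rw [Real.exp_neg, one_div]
  exact inv_anti₀ (by norm_num) (by linarith [Real.add_one_le_exp x])

/-- The final balance with X = e^K and l = e^L. The right side is e^{-(C₁+3)X}. Each of the two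
terms on the left, exceptional mass and test error, is smaller by a further factor e^{-X} ≤ 1/2,
which is why the constant is 4. -/
theorem exp_mul_add_exp_le {B C₁ C₂ c X l : ℝ} (hC₂ : 0 < C₂) (hX1 : 1 ≤ X)
    (hL : B + C₁ + C₂ + 4 ≤ c * l) :
    Real.exp (B * X) * (C₂ * Real.exp (-(c * (X * l))) + Real.exp (-((B + C₁ + 4) * X))) ≤
      Real.exp (-X) * Real.exp (-(C₁ * X)) * Real.exp (-X) ^ 2 := by
  have hhalf : Real.exp (-X) ≤ 1 / 2 := exp_neg_le_half hX1
  have e0 : Real.exp (-X) * Real.exp (-(C₁ * X)) * Real.exp (-X) ^ 2 =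
      Real.exp (-((C₁ + 3) * X)) := by
    rw [← Real.exp_nat_mul, ← Real.exp_add, ← Real.exp_add]
    congr 1
    push_cast
    ring
  have e1 : Real.exp (B * X) * Real.exp (-((B + C₁ + 4) * X)) =
      Real.exp (-((C₁ + 3) * X)) * Real.exp (-X) := by
    rw [← Real.exp_add, ← Real.exp_add]
    ring_nf
  have e2 : Real.exp (B * X) * (C₂ * Real.exp (-(c * (X * l)))) ≤
      Real.exp (-((C₁ + 3) * X)) * Real.exp (-X) := by
    have h1 : C₂ ≤ Real.exp (C₂ * X) := by
      have := Real.add_one_le_exp (C₂ * X)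
      nlinarith
    calc _ ≤ Real.exp (B * X) * (Real.exp (C₂ * X) * Real.exp (-(c * (X * l)))) := by
          gcongr
      _ = Real.exp (B * X + (C₂ * X + -(c * (X * l)))) := by
          rw [Real.exp_add, Real.exp_add]
      _ ≤ Real.exp (-((C₁ + 3) * X) + -X) := by
          refine Real.exp_le_exp.2 ?_
          nlinarith
      _ = _ := Real.exp_add _ _
  rw [mul_add, e0, e1]
  have h2 := mul_le_mul_of_nonneg_left hhalf (Real.exp_pos (-((C₁ + 3) * X))).le
  linarith

/-- The expected posterior mass outside a ball of radius `M ε`, for a fixed sample size `n` and a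
cut-off `K` with `n ≍ exp((2α+1)K)`. -/
theorem lintegral_blockPosterior_le {Ω : Type*} [MeasurableSpace Ω] {P : Measure Ω}
    [IsProbabilityMeasure P] {W : ℝ≥0 → Ω → ℝ} (hμ : IsIsonormal (pathLaw P W))
    {G : MixingDensities} (hG : G.InClass) {α B C₁ C₂ c M : ℝ} (hα : 0 < α) (hB : 0 < B)
    (hC₁ : 0 < C₁) (hC₂ : 0 < C₂) {L : ℕ} (hL : B + C₁ + C₂ + 4 ≤ c * Real.exp L)
    (hM0 : 0 ≤ M) (hM : 256 * Real.exp (2 * α + 1) * (Real.exp L + B + C₁ + 4) ≤ M ^ 2)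
    {n K : ℕ} (hn : 0 < n)
    (hnK : (n : ℝ) ≤ Real.exp ((2 * α + 1) * K))
    (hKn : Real.exp ((2 * α + 1) * K) ≤ Real.exp (2 * α + 1) * n) {f₀ : Signal}
    (hball : ENNReal.ofReal (Real.exp (-(C₁ * Real.exp K))) ≤
      blockPrior G {f | ‖f - f₀‖ ^ 2 ≤ B * Real.exp (-(2 * α * K))})
    (htail : blockPrior G {f | B * Real.exp (-(2 * α * (K + L : ℕ))) <
        tailEnergy (blockStart (K + L) - 1) f} ≤
      ENNReal.ofReal (C₂ * Real.exp (-(c * Real.exp (K + L : ℕ)))))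
    (hf₀ : tailEnergy (blockStart (K + L) - 1) f₀ ≤ B * Real.exp (-(2 * α * (K + L : ℕ)))) :
    ∫⁻ y, blockPosterior P W G n y {f | M * rate α n < ‖f - f₀‖} ∂(whiteNoise P W n f₀) ≤
      3 * ENNReal.ofReal (Real.exp (-(Real.exp K))) := by
  set X := Real.exp K with hX
  set J := blockStart (K + L) - 1 with hJ
  set R := M * Real.exp (-(α * K)) with hR
  have hX1 : 1 ≤ X := Real.one_le_exp (Nat.cast_nonneg K)
  have hXL : Real.exp (K + L : ℕ) = X * Real.exp L := by rw [hX, ← Real.exp_add]; push_cast; rfl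
  have hR2 : R ^ 2 = M ^ 2 * Real.exp (-(2 * α * K)) := by
    rw [hR, mul_pow, ← Real.exp_nat_mul]
    congr 2
    push_cast
    ring
  have hXprod : Real.exp ((2 * α + 1) * K) * Real.exp (-(2 * α * K)) = X := by
    rw [hX, ← Real.exp_add]
    ring_nf
  have hmono : Real.exp (-(2 * α * (K + L : ℕ))) ≤ Real.exp (-(2 * α * K)) := by
    refine Real.exp_le_exp.2 (neg_le_neg ?_)
    gcongr
    exact Nat.le_add_right K L
  have heβ : 1 ≤ Real.exp (2 * α + 1) := Real.one_le_exp (by linarith)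
  have hRrate : R ≤ M * rate α n := by
    refine mul_le_mul_of_nonneg_left ?_ hM0
    calc Real.exp (-(α * K)) = Real.exp ((2 * α + 1) * K) ^ (-(α / (2 * α + 1))) := by
          rw [← Real.exp_mul]
          congr 1
          field_simp
      _ ≤ rate α n := Real.rpow_le_rpow_of_nonpos (by exact_mod_cast hn) hnK
          (neg_nonpos.2 (by positivity))
  have hR0 : 0 ≤ R := by positivity
  obtain ⟨E, hE, hE0, hE1⟩ := exists_test hμ hn f₀ J R
  have hJX : (J : ℝ) ≤ X * Real.exp L := hXL ▸ blockStart_sub_one_le_exp (K + L)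
  -- The factor e^{2α+1} in the bound for M² compensates for the rounding of `K`: n may be smaller
  -- than e^{(2α+1)K} by that factor.
  have hnR : (Real.exp L + B + C₁ + 4) * X ≤ n * R ^ 2 / 64 / 4 := by
    have h1 : 256 * (Real.exp L + B + C₁ + 4) * Real.exp ((2 * α + 1) * K) ≤ M ^ 2 * n := by
      calc _ ≤ 256 * (Real.exp L + B + C₁ + 4) * (Real.exp (2 * α + 1) * n) := by gcongr
        _ = 256 * Real.exp (2 * α + 1) * (Real.exp L + B + C₁ + 4) * n := by ring
        _ ≤ _ := by gcongr
    have h2 := mul_le_mul_of_nonneg_right h1 (Real.exp_pos (-(2 * α * K))).le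
    rw [mul_assoc, hXprod] at h2
    rw [hR2]
    linarith
  have htest : (J : ℝ) - n * R ^ 2 / 64 ≤ -((B + C₁ + 4) * X) := by
    have h0 : 0 ≤ n * R ^ 2 := by positivity
    linarith
  set T : Set Signal := {f | B * Real.exp (-(2 * α * (K + L : ℕ))) < tailEnergy J f} with hT
  set A : Set Signal := {f | M * rate α n < ‖f - f₀‖} with hA
  have hAm : MeasurableSet A := measurableSet_lt measurable_const (by fun_prop)
  have hTm : MeasurableSet T :=
    measurableSet_lt measurable_const (continuous_tailEnergy _).measurable
  have hpow : ∀ f ∈ A, f ∉ T → whiteNoise P W n f Eᶜ ≤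
      ENNReal.ofReal (Real.exp (-((B + C₁ + 4) * X))) := by
    intro f hfA hfT
    refine (hE1 f (pow_le_pow_left₀ hR0 (hRrate.trans (le_of_lt hfA)) 2) ?_).trans
      (ENNReal.ofReal_le_ofReal (Real.exp_le_exp.2 htest))
    rw [← tailEnergy_eq]
    have h1 := tailEnergy_sub_le J f f₀
    have h2 : tailEnergy J f ≤ B * Real.exp (-(2 * α * (K + L : ℕ))) := not_lt.1 hfT
    have h3 : B * Real.exp (-(2 * α * (K + L : ℕ))) ≤ B * Real.exp (-(2 * α * K)) := by gcongr
    -- The tails of f and f₀ together contribute at most 4B e^{-2αK}, and the test tolerates R²/64.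
    -- This explains 256 = 4 · 64.
    have h4 : 256 * B ≤ M ^ 2 := by
      refine le_trans ?_ hM
      have h5 : B ≤ Real.exp L + B + C₁ + 4 := by linarith [Real.exp_pos (L : ℝ)]
      nlinarith
    have h6 := mul_le_mul_of_nonneg_right h4 (Real.exp_pos (-(2 * α * K))).le
    rw [hR2]
    linarith
  have hint := setLIntegral_le_measure_add (blockPrior_le_one hG Set.univ) hAm hTm
    (fun f => whiteNoise_le_one hμ n f Eᶜ) hpow
  have hU0 : blockPrior G {f | ‖f - f₀‖ ^ 2 ≤ B * Real.exp (-(2 * α * K))} ≠ 0 :=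
    (lt_of_lt_of_le (ENNReal.ofReal_pos.2 (Real.exp_pos _)) hball).ne'
  -- On the ball n‖f - f₀‖² ≤ B e^K, which gives the two-point constant. The threshold and the
  -- resulting error are both set to exp(-e^K).
  have hmain := lintegral_posterior_le (whiteNoise P W n) (blockPrior G) f₀
    (whiteNoise_le_one hμ n f₀ _) hAm hU0 hE (K := ENNReal.ofReal (Real.exp (B * X)))
    (s := ENNReal.ofReal (Real.exp (-X))) (δ := ENNReal.ofReal (Real.exp (-X)))
    (ENNReal.ofReal_pos.2 (Real.exp_pos _)).ne' ENNReal.ofReal_ne_top ?_ ?_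
  · refine hmain.trans ?_
    have h1 : whiteNoise P W n f₀ E ≤ ENNReal.ofReal (Real.exp (-X)) := by
      refine hE0.trans (ENNReal.ofReal_le_ofReal (Real.exp_le_exp.2 (htest.trans ?_)))
      nlinarith
    calc _ ≤ ENNReal.ofReal (Real.exp (-X)) + ENNReal.ofReal (Real.exp (-X)) +
          ENNReal.ofReal (Real.exp (-X)) := by gcongr
      _ = _ := by ring
  · intro f hf D hD
    refine (sq_whiteNoise_le hμ hn f₀ f hD).trans ?_
    gcongr ENNReal.ofReal (Real.exp ?_) * _
    calc n * ‖f - f₀‖ ^ 2 ≤ Real.exp ((2 * α + 1) * K) * (B * Real.exp (-(2 * α * K))) := by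
          gcongr
          exact hf
      _ = B * X := by rw [← hXprod]; ring
  · calc _ ≤ ENNReal.ofReal (Real.exp (B * X)) *
          (ENNReal.ofReal (C₂ * Real.exp (-(c * (X * Real.exp L)))) +
            ENNReal.ofReal (Real.exp (-((B + C₁ + 4) * X)))) := by
          gcongr
          refine hint.trans ?_
          gcongr
          rw [← hXL]
          exact htail
      _ = ENNReal.ofReal (Real.exp (B * X) * (C₂ * Real.exp (-(c * (X * Real.exp L))) +
            Real.exp (-((B + C₁ + 4) * X)))) := by
          rw [← ENNReal.ofReal_add (by positivity) (by positivity),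
            ← ENNReal.ofReal_mul (by positivity)]
      _ ≤ ENNReal.ofReal (Real.exp (-X) * Real.exp (-(C₁ * X)) * Real.exp (-X) ^ 2) :=
          ENNReal.ofReal_le_ofReal (exp_mul_add_exp_le hC₂ hX1 hL)
      _ = ENNReal.ofReal (Real.exp (-X)) * ENNReal.ofReal (Real.exp (-(C₁ * X))) *
            ENNReal.ofReal (Real.exp (-X)) ^ 2 := by
          rw [ENNReal.ofReal_mul (by positivity), ENNReal.ofReal_mul (by positivity),
            ENNReal.ofReal_pow (Real.exp_pos _).le]
      _ ≤ _ := by gcongr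

/-- The smallest `K ≥ 1` with `n < exp(bK)`. -/
def cutoff (b : ℝ) (n : ℕ) : ℕ := ⌊Real.log n / b⌋₊ + 1

theorem le_exp_mul_cutoff {b : ℝ} (hb : 0 < b) {n : ℕ} (hn : 0 < n) :
    (n : ℝ) ≤ Real.exp (b * cutoff b n) := by
  have h := (Nat.lt_floor_add_one (Real.log n / b)).le
  rw [div_le_iff₀ hb] at h
  rw [← Real.log_le_iff_le_exp (by exact_mod_cast hn), cutoff]
  push_cast
  linarith

theorem exp_mul_cutoff_le {b : ℝ} (hb : 0 < b) {n : ℕ} (hn : 0 < n) :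
    Real.exp (b * cutoff b n) ≤ Real.exp b * n := by
  have hn' : (0 : ℝ) < n := by exact_mod_cast hn
  have h := Nat.floor_le (div_nonneg (Real.log_nonneg (show (1 : ℝ) ≤ n by exact_mod_cast hn)) hb.le)
  rw [le_div_iff₀ hb] at h
  calc Real.exp (b * cutoff b n) ≤ Real.exp (b + Real.log n) := by
        refine Real.exp_le_exp.2 ?_
        rw [cutoff]
        push_cast
        linarith
    _ = _ := by rw [Real.exp_add, Real.exp_log hn']

theorem tendsto_cutoff {b : ℝ} (hb : 0 < b) : Tendsto (cutoff b) atTop atTop := by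
  refine (tendsto_add_atTop_nat 1).comp (tendsto_nat_floor_atTop.comp ?_)
  exact (Real.tendsto_log_atTop.comp tendsto_natCast_atTop_atTop).atTop_div_const hb

end BlockPrior

end

open BlockPrior
/-- Adaptive posterior contraction of the block prior in the white noise model. -/
theorem theorem3p2 (G : MixingDensities) (hG : G.InClass) (α Q : ℝ) (hα : 0 < α) (hQ : 0 < Q) :
    ∃ M : ℝ, 0 < M ∧
      ∀ (Ω : Type*) [MeasurableSpace Ω] (P : Measure Ω) [IsProbabilityMeasure P]
        (W : ℝ≥0 → Ω → ℝ), IsBrownianReal W P →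
        Tendsto (fun n : ℕ => ⨆ f₀ ∈ sobolevBall α Q,
            ∫⁻ y, blockPosterior P W G n y {f | M * rate α n < ‖f - f₀‖}
              ∂(whiteNoise P W n f₀))
          atTop (𝓝 0) := by
  obtain ⟨B, C₁, C₂, c, hB, hC₁, hC₂, hc, hball, htail, hf₀⟩ := exists_blockPrior_bounds hG hα Q
  -- The sieve is cut `L` blocks beyond `K`, so that its exceptional mass is negligible against the
  -- prior mass of the ball. `L` does not depend on n, so the test dimension stays of order e^K.
  obtain ⟨L, hL⟩ : ∃ L : ℕ, B + C₁ + C₂ + 4 ≤ c * Real.exp L :=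
    (((Real.tendsto_exp_atTop.comp tendsto_natCast_atTop_atTop).const_mul_atTop
      hc).eventually_ge_atTop _).exists
  set S := 256 * Real.exp (2 * α + 1) * (Real.exp L + B + C₁ + 4) with hS
  have hS0 : 0 < S := by positivity
  have hb : 0 < 2 * α + 1 := by linarith
  refine ⟨√S, Real.sqrt_pos.2 hS0, fun Ω _ P _ W hW => ?_⟩
  have hμ := isIsonormal_pathLaw hW.toIsPreBrownianReal (aemeasurable_path hW)
  have hlim : Tendsto (fun n : ℕ =>
      3 * ENNReal.ofReal (Real.exp (-(Real.exp (cutoff (2 * α + 1) n))))) atTop (𝓝 0) := by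
    have h1 := (tendsto_exp_neg_mul_exp one_pos 1).comp (tendsto_cutoff hb)
    have h2 := ENNReal.Tendsto.const_mul (a := 3) ((ENNReal.continuous_ofReal.tendsto 0).comp h1)
      (Or.inr (by simp))
    rw [ENNReal.ofReal_zero, mul_zero] at h2
    refine h2.congr fun n => ?_
    simp
  refine tendsto_of_tendsto_of_tendsto_of_le_of_le' tendsto_const_nhds hlim
    (Eventually.of_forall fun _ => zero_le) ?_
  filter_upwards [(tendsto_cutoff hb).eventually hball, eventually_gt_atTop 0] with n hn hn0
  exact iSup₂_le fun f hf => lintegral_blockPosterior_le hμ hG hα hB hC₁ hC₂ hL (Real.sqrt_nonneg _)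
    (Real.sq_sqrt hS0.le).ge hn0 (le_exp_mul_cutoff hb hn0) (exp_mul_cutoff_le hb hn0) (hn f hf)
    (htail _) (hf₀ _ f hf)
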